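/- Let $\boldsymbol f:\mathbb R/\mathbb Z\times[0,\infty)\to\mathbb R^2$, $(u,t)\mapsto\boldsymbol f(u,t)$, be smooth with $\partial_u\boldsymbol f\neq 0$ everywhere, so that each $\boldsymbol f(\cdot,t)$ is a closed immersed (not necessarily embedded or convex) plane curve. For each $t$ let $s$ denote its arc-length parameter ($ds=|\partial_u \boldsymbol f|\,du$, $\partial_s=|\partial_u\boldsymbol f|^{-1}\partial_u$), $L=L(t)$ its length, $\boldsymbol\nu=(-\partial_s f_2,\partial_s f_1)$ its unit normal, $\boldsymbol\kappa=\partial_s^2\boldsymbol f$ its curvature vector, $\kappa=\boldsymbol\kappa\cdot\boldsymbol\nu$ its signed curvature, $A=-\frac12\int_0^L\boldsymbol f\cdot\boldsymbol\nu\,ds$ its signed area, $\tilde\kappa=\kappa-\frac1L\int_0^L\kappa\,ds$ the deviation of its curvature, and for each integer $\ell\ge 0$ $$I_\ell(t)=L^{2\ell+1}\int_0^L|\partial_s^\ell\tilde\kappa|^2\,ds .$$ Assume that $\boldsymbol f$ is a global solution of the length-preserving flow $$\partial_t\boldsymbol f=\boldsymbol\kappa-\Bigl(\frac1{2\pi}\int_0^L\|\boldsymbol\kappa\|^2\,ds\Bigr)\boldsymbol\nu\qquad\text{for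 all }t\ge 0,$$ where $\partial_t$ is taken at fixed $u$, and that the initial curve $\boldsymbol f(\cdot,0)$ has rotation number $1$ and positive signed area. Then for each integer $\ell\ge 0$ there exist $C_\ell>0$ and $\lambda_\ell>0$ such that $$I_\ell(t)\le C_\ell e^{-\lambda_\ell t}\qquad\text{for all }t\ge 0 .$$ -/

import Mathlib

open scoped ContDiff

namespace PlaneCurve

/-- The Euclidean plane is identified with `ℂ` (with its real inner product), so that the rotation
by a right angle `(x, y) ↦ (-y, x)` is multiplication by `Complex.I`. A closed plane curve is given
by a `1`-periodic map `γ : ℝ → ℂ` with nowhere vanishing derivative. This is the derivative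
`∂ₛ = |γ'|⁻¹ ∂ᵤ` with respect to arc length along `γ`. -/
noncomputable def arcDeriv {E : Type*} [NormedAddCommGroup E] [NormedSpace ℝ E]
    (γ : ℝ → ℂ) (g : ℝ → E) : ℝ → E :=
  fun u => ‖deriv γ u‖⁻¹ • deriv g u

/-- The integral `∫ g ds` over one period, with respect to arc length of `γ`. -/
noncomputable def arcIntegral (γ : ℝ → ℂ) (g : ℝ → ℝ) : ℝ :=
  ∫ u in (0 : ℝ)..1, g u * ‖deriv γ u‖

/-- The length `L`. -/
noncomputable def length (γ : ℝ → ℂ) : ℝ := arcIntegral γ (fun _ => 1)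

/-- The unit tangent vector `∂ₛ γ`. -/
noncomputable def tangent (γ : ℝ → ℂ) : ℝ → ℂ := arcDeriv γ γ

/-- The unit normal vector `ν = (-∂ₛγ₂, ∂ₛγ₁)`. -/
noncomputable def normal (γ : ℝ → ℂ) : ℝ → ℂ := fun u => Complex.I * tangent γ u

/-- The curvature vector `∂ₛ² γ`. -/
noncomputable def curvatureVector (γ : ℝ → ℂ) : ℝ → ℂ := arcDeriv γ (tangent γ)

/-- The signed curvature `κ`, the inner product of the curvature vector and the normal. -/
noncomputable def curvature (γ : ℝ → ℂ) : ℝ → ℝ :=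
  fun u => inner ℝ (curvatureVector γ u) (normal γ u)

/-- The signed area `A = -(1/2) ∫ γ · ν ds`. -/
noncomputable def signedArea (γ : ℝ → ℂ) : ℝ :=
  -(1 / 2 : ℝ) * arcIntegral γ (fun u => inner ℝ (γ u) (normal γ u))

/-- The deviation of curvature from its mean, `κ - (1/L) ∫ κ ds`. -/
noncomputable def curvatureDeviation (γ : ℝ → ℂ) : ℝ → ℝ :=
  fun u => curvature γ u - 1 / length γ * arcIntegral γ (curvature γ)

/-- The scale-invariant quantity `I_ℓ = L^(2ℓ+1) ∫ |∂ₛ^ℓ (κ - mean of κ)|² ds`. -/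
noncomputable def devEnergy (l : ℕ) (γ : ℝ → ℂ) : ℝ :=
  length γ ^ (2 * l + 1) *
    arcIntegral γ (fun u => |((arcDeriv γ)^[l] (curvatureDeviation γ)) u| ^ 2)

/-- The closed curve `γ` has rotation number `n`: a continuous angle `θ` of the unit tangent
increases by `2πn` along one period. -/
def HasRotationNumber (γ : ℝ → ℂ) (n : ℤ) : Prop :=
  ∃ θ : ℝ → ℝ, Continuous θ ∧ (∀ u, tangent γ u = Complex.exp (θ u * Complex.I)) ∧
    θ 1 - θ 0 = 2 * Real.pi * n

/-- `f u t`, for `t ≥ 0`, is a global smooth solution of the length-preserving flow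
`∂ₜ f = κ⃗ - ((1/2π) ∫ ‖κ⃗‖² ds) ν` of closed immersed plane curves `f · t`; here `∂ₜ` is taken at
a fixed value of the parameter `u`. Values of `f` at negative times play no role. -/
structure IsGlobalLengthPreservingFlow (f : ℝ → ℝ → ℂ) : Prop where
  smooth : ContDiffOn ℝ ∞ (fun p : ℝ × ℝ => f p.1 p.2) (Set.univ ×ˢ Set.Ici 0)
  periodic : ∀ t, 0 ≤ t → ∀ u, f (u + 1) t = f u t
  immersed : ∀ t, 0 ≤ t → ∀ u, deriv (fun v => f v t) u ≠ 0
  flow : ∀ t, 0 ≤ t → ∀ u,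
    HasDerivWithinAt (fun τ => f u τ)
      (curvatureVector (fun v => f v t) u -
        (1 / (2 * Real.pi) *
          arcIntegral (fun v => f v t) (fun w => ‖curvatureVector (fun v => f v t) w‖ ^ 2)) •
          normal (fun v => f v t) u)
      (Set.Ici 0) t

end PlaneCurve

/-! Write `w = κ - 2π/L`, `F = κ - (1/2π)∫κ² ds` for the normal speed, and `E_n = ∫ |∂ₛⁿ w|² ds`.
The flow conserves the total curvature `2π` (`arcInt_curv`), hence the length `L` (`length_eq`). So
`w` is the curvature deviation for all times, `I_n = L^(2n+1) E_n`, and it suffices to show that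
each `E_n` decays exponentially.

The decay originates in the isoperimetric deficit `D = L² - 4πA`. The area grows at the rate `(L/2π)
E_0` (`hasDerivAt_signedArea`), so `D' = -2L E_0`. Conversely, a reverse isoperimetric estimate `|D|
≤ L³ E_0` (`abs_deficit_le`) holds for every closed curve, and `D` is bounded below. A function with
these properties must be nonnegative and decay like `exp(-2t/L²)`, and then so do the integrals of
`E_0` over unit time intervals (`integral_le_exp_of_deficit`). Neither convexity nor embeddedness
enters.

To pass to pointwise decay, one proves `E_n' ≤ -E_{n+1} + C (E_n + E_n³)`. With exponentially small
unit integrals of `E_n`, this inequality gives exponential decay of `E_n` and of the unit integrals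
of `E_{n+1}` (`exp_decay_of_integral`), so an induction on `n` runs with one rate for all orders.
For `n ≥ 1` the inequality follows from the structure of the evolution equation: each error term
contains at most one factor of top order `n`, and the others are bounded uniformly by `E_n`
(`exists_bound_of_isLower`). The case `n = 0` contains the critical integral of `w⁴` and needs an
absorption into `E_1` (`hasDerivAt_energy_zero_le`). -/

namespace PlaneCurve

/-- A smooth immersed closed plane curve, as a `1`-periodic map. -/
structure IsLoop (γ : ℝ → ℂ) : Prop where
  smooth : ContDiff ℝ ∞ γ
  periodic : Function.Periodic γ 1
  immersed : ∀ u, deriv γ u ≠ 0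

/-! ### Calculus with respect to arc length on one closed curve -/

section Loop

variable {E : Type*} [NormedAddCommGroup E] [NormedSpace ℝ E] {γ : ℝ → ℂ}

theorem _root_.Function.Periodic.deriv' {g : ℝ → E} (hg : Function.Periodic g 1) :
    Function.Periodic (deriv g) 1 := fun u => by
  have h : (fun v => g (v + 1)) = g := funext hg
  rw [← deriv_comp_add_const, h]

theorem contDiff_deriv {g : ℝ → E} (hg : ContDiff ℝ ∞ g) : ContDiff ℝ ∞ (deriv g) :=
  (contDiff_infty_iff_deriv.1 hg).2

namespace IsLoop

theorem speed_pos (hγ : IsLoop γ) (u : ℝ) : 0 < ‖deriv γ u‖ := norm_pos_iff.2 (hγ.immersed u)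

theorem contDiff_speed (hγ : IsLoop γ) : ContDiff ℝ ∞ (fun u => ‖deriv γ u‖) :=
  (contDiff_deriv hγ.smooth).norm ℝ hγ.immersed

theorem continuous_speed (hγ : IsLoop γ) : Continuous (fun u => ‖deriv γ u‖) :=
  hγ.contDiff_speed.continuous

theorem contDiff_arcDeriv (hγ : IsLoop γ) {g : ℝ → E} (hg : ContDiff ℝ ∞ g) :
    ContDiff ℝ ∞ (arcDeriv γ g) :=
  (hγ.contDiff_speed.inv fun u => (hγ.speed_pos u).ne').smul (contDiff_deriv hg)

theorem periodic_arcDeriv (hγ : IsLoop γ) {g : ℝ → E} (hg : Function.Periodic g 1) :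
    Function.Periodic (arcDeriv γ g) 1 := fun u => by
  simp only [arcDeriv, hγ.periodic.deriv' u, hg.deriv' u]

theorem deriv_eq (hγ : IsLoop γ) (g : ℝ → E) (u : ℝ) :
    deriv g u = ‖deriv γ u‖ • arcDeriv γ g u := by
  rw [arcDeriv, smul_inv_smul₀ (hγ.speed_pos u).ne']

theorem deriv_eq_tangent (hγ : IsLoop γ) (u : ℝ) : deriv γ u = ‖deriv γ u‖ * tangent γ u := by
  rw [tangent, ← Complex.real_smul, ← hγ.deriv_eq]

theorem contDiff_tangent (hγ : IsLoop γ) : ContDiff ℝ ∞ (tangent γ) :=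
  hγ.contDiff_arcDeriv hγ.smooth

theorem norm_tangent (hγ : IsLoop γ) (u : ℝ) : ‖tangent γ u‖ = 1 := by
  rw [tangent, arcDeriv, norm_smul, norm_inv, norm_norm, inv_mul_cancel₀ (hγ.speed_pos u).ne']

theorem contDiff_normal (hγ : IsLoop γ) : ContDiff ℝ ∞ (normal γ) :=
  contDiff_const.mul hγ.contDiff_tangent

theorem contDiff_curvatureVector (hγ : IsLoop γ) : ContDiff ℝ ∞ (curvatureVector γ) :=
  hγ.contDiff_arcDeriv hγ.contDiff_tangent

theorem contDiff_curvature (hγ : IsLoop γ) : ContDiff ℝ ∞ (curvature γ) :=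
  hγ.contDiff_curvatureVector.inner ℝ hγ.contDiff_normal

/-- The tangent has constant norm, so its derivative is orthogonal to it and hence a real multiple
of the normal. -/
theorem curvatureVector_eq (hγ : IsLoop γ) (u : ℝ) :
    curvatureVector γ u = curvature γ u * normal γ u := by
  have h1 : HasDerivAt (tangent γ) (deriv (tangent γ) u) u :=
    (hγ.contDiff_tangent.differentiable (by simp) u).hasDerivAt
  have h2 := h1.norm_sq
  have h3 : (fun u => ‖tangent γ u‖ ^ 2) = fun _ => (1 : ℝ) := by
    funext u; rw [hγ.norm_tangent]; norm_num
  rw [h3] at h2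
  have h4 : inner ℝ (tangent γ u) (curvatureVector γ u) = 0 := by
    have := h2.unique (hasDerivAt_const u (1 : ℝ))
    rw [curvatureVector, arcDeriv, inner_smul_right]
    have h5 : inner ℝ (tangent γ u) (deriv (tangent γ) u) = 0 := by linarith
    rw [h5, mul_zero]
  have h6 : (tangent γ u).re ^ 2 + (tangent γ u).im ^ 2 = 1 := by
    have := hγ.norm_tangent u
    have h7 := Complex.sq_norm (tangent γ u)
    rw [this, Complex.normSq_apply] at h7
    linarith
  rw [curvature, normal]
  generalize curvatureVector γ u = z at *
  generalize tangent γ u = T at *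
  rw [Complex.inner] at h4 ⊢
  simp only [Complex.mul_re, Complex.conj_re, Complex.conj_im] at h4
  apply Complex.ext
  · simp
    linear_combination (-z.re) * h6 + T.re * h4
  · simp
    linear_combination (-z.im) * h6 + T.im * h4

theorem norm_normal (hγ : IsLoop γ) (u : ℝ) : ‖normal γ u‖ = 1 := by
  rw [normal, norm_mul, Complex.norm_I, hγ.norm_tangent, one_mul]

theorem sq_norm_curvatureVector (hγ : IsLoop γ) (u : ℝ) :
    ‖curvatureVector γ u‖ ^ 2 = curvature γ u ^ 2 := by
  rw [hγ.curvatureVector_eq, norm_mul, hγ.norm_normal, mul_one, Complex.norm_real, Real.norm_eq_abs,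
    sq_abs]

theorem deriv_tangent (hγ : IsLoop γ) (u : ℝ) :
    deriv (tangent γ) u = ‖deriv γ u‖ * (curvature γ u * (Complex.I * tangent γ u)) := by
  rw [hγ.deriv_eq, Complex.real_smul]
  exact congrArg _ (hγ.curvatureVector_eq u)

theorem hasDerivAt_tangent (hγ : IsLoop γ) (u : ℝ) :
    HasDerivAt (tangent γ) (‖deriv γ u‖ * (curvature γ u * (Complex.I * tangent γ u))) u := by
  rw [← hγ.deriv_tangent]
  exact (hγ.contDiff_tangent.differentiable (by simp) u).hasDerivAt

theorem hasDerivAt (hγ : IsLoop γ) (u : ℝ) : HasDerivAt γ (‖deriv γ u‖ * tangent γ u) u := by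
  rw [← hγ.deriv_eq_tangent]
  exact (hγ.smooth.differentiable (by simp) u).hasDerivAt

/-! ### Integration with respect to arc length -/

theorem intervalIntegrable (hγ : IsLoop γ) {g : ℝ → ℝ} (hg : Continuous g) (a b : ℝ) :
    IntervalIntegrable (fun u => g u * ‖deriv γ u‖) MeasureTheory.volume a b :=
  (hg.mul hγ.continuous_speed).intervalIntegrable a b

theorem arcIntegral_add (hγ : IsLoop γ) {g h : ℝ → ℝ} (hg : Continuous g) (hh : Continuous h) :
    arcIntegral γ (fun u => g u + h u) = arcIntegral γ g + arcIntegral γ h := by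
  simp only [arcIntegral, add_mul]
  exact intervalIntegral.integral_add (hγ.intervalIntegrable hg _ _) (hγ.intervalIntegrable hh _ _)

theorem arcIntegral_sub (hγ : IsLoop γ) {g h : ℝ → ℝ} (hg : Continuous g) (hh : Continuous h) :
    arcIntegral γ (fun u => g u - h u) = arcIntegral γ g - arcIntegral γ h := by
  simp only [arcIntegral, sub_mul]
  exact intervalIntegral.integral_sub (hγ.intervalIntegrable hg _ _) (hγ.intervalIntegrable hh _ _)

theorem _root_.PlaneCurve.arcIntegral_const_mul (γ : ℝ → ℂ) (c : ℝ) (g : ℝ → ℝ) :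
    arcIntegral γ (fun u => c * g u) = c * arcIntegral γ g := by
  simp only [arcIntegral, mul_assoc]
  exact intervalIntegral.integral_const_mul _ _

theorem _root_.PlaneCurve.arcIntegral_const (γ : ℝ → ℂ) (c : ℝ) :
    arcIntegral γ (fun _ => c) = c * length γ := by
  rw [length, ← arcIntegral_const_mul]; simp

theorem arcIntegral_mono (hγ : IsLoop γ) {g h : ℝ → ℝ} (hg : Continuous g) (hh : Continuous h)
    (hgh : ∀ u ∈ Set.Icc (0 : ℝ) 1, g u ≤ h u) : arcIntegral γ g ≤ arcIntegral γ h :=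
  intervalIntegral.integral_mono_on zero_le_one (hγ.intervalIntegrable hg _ _)
    (hγ.intervalIntegrable hh _ _)
    fun u hu => mul_le_mul_of_nonneg_right (hgh u hu) (norm_nonneg _)

theorem _root_.PlaneCurve.arcIntegral_nonneg {g : ℝ → ℝ} (hg : ∀ u, 0 ≤ g u) :
    0 ≤ arcIntegral γ g :=
  intervalIntegral.integral_nonneg zero_le_one fun u _ => mul_nonneg (hg u) (norm_nonneg _)

theorem abs_arcIntegral_le (hγ : IsLoop γ) {g h : ℝ → ℝ} (hg : Continuous g) (hh : Continuous h)
    (hgh : ∀ u ∈ Set.Icc (0 : ℝ) 1, |g u| ≤ h u) : |arcIntegral γ g| ≤ arcIntegral γ h := by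
  rw [abs_le]
  constructor
  · rw [neg_eq_neg_one_mul, ← arcIntegral_const_mul]
    exact hγ.arcIntegral_mono (by fun_prop) hg fun u hu => by
      have := (abs_le.1 (hgh u hu)).1; linarith
  · exact hγ.arcIntegral_mono hg hh fun u hu => (abs_le.1 (hgh u hu)).2

theorem length_pos (hγ : IsLoop γ) : 0 < length γ := by
  rw [length, arcIntegral]
  simp only [one_mul]
  exact intervalIntegral.intervalIntegral_pos_of_pos
    (hγ.continuous_speed.intervalIntegrable _ _) hγ.speed_pos zero_lt_one

theorem arcIntegral_arcDeriv (hγ : IsLoop γ) {g : ℝ → ℝ} (hg : ContDiff ℝ ∞ g)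
    (hp : Function.Periodic g 1) : arcIntegral γ (arcDeriv γ g) = 0 := by
  have h1 : arcIntegral γ (arcDeriv γ g) = ∫ u in (0 : ℝ)..1, deriv g u := by
    refine intervalIntegral.integral_congr fun u _ => ?_
    simp only [hγ.deriv_eq g u, smul_eq_mul, mul_comm]
  rw [h1, intervalIntegral.integral_deriv_eq_sub
    (fun u _ => hg.differentiable (by simp) u)
    ((contDiff_deriv hg).continuous.intervalIntegrable _ _)]
  have := hp 0
  rw [zero_add] at this
  rw [this, sub_self]

theorem _root_.PlaneCurve.arcDeriv_mul {g h : ℝ → ℝ} (hg : ContDiff ℝ ∞ g) (hh : ContDiff ℝ ∞ h)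
    (u : ℝ) : arcDeriv γ (fun u => g u * h u) u
      = arcDeriv γ g u * h u + g u * arcDeriv γ h u := by
  simp only [arcDeriv, smul_eq_mul]
  rw [deriv_fun_mul (hg.differentiable (by simp) u) (hh.differentiable (by simp) u)]
  ring

theorem arcIntegral_by_parts (hγ : IsLoop γ) {g h : ℝ → ℝ} (hg : ContDiff ℝ ∞ g)
    (hh : ContDiff ℝ ∞ h) (hgp : Function.Periodic g 1) (hhp : Function.Periodic h 1) :
    arcIntegral γ (fun u => g u * arcDeriv γ h u)
      = - arcIntegral γ (fun u => arcDeriv γ g u * h u) := by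
  have h1 := hγ.arcIntegral_arcDeriv (hg.mul hh) (fun u => by rw [hgp, hhp])
  have h2 : arcDeriv γ (fun u => g u * h u)
      = fun u => arcDeriv γ g u * h u + g u * arcDeriv γ h u := funext (arcDeriv_mul hg hh)
  rw [h2, hγ.arcIntegral_add] at h1
  · linarith
  · exact (hγ.contDiff_arcDeriv hg).continuous.mul hh.continuous
  · exact hg.continuous.mul (hγ.contDiff_arcDeriv hh).continuous

/-- Cauchy–Schwarz, from the discriminant of the nonnegative quadratic `x ↦ ∫ (a x + b)² ds`. -/
theorem sq_arcIntegral_mul_le (hγ : IsLoop γ) {a b : ℝ → ℝ} (ha : Continuous a)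
    (hb : Continuous b) : arcIntegral γ (fun u => a u * b u) ^ 2
      ≤ arcIntegral γ (fun u => a u ^ 2) * arcIntegral γ (fun u => b u ^ 2) := by
  have h : ∀ x : ℝ, 0 ≤ arcIntegral γ (fun u => a u ^ 2) * (x * x)
      + (2 * arcIntegral γ (fun u => a u * b u)) * x + arcIntegral γ (fun u => b u ^ 2) := by
    intro x
    have h1 : 0 ≤ arcIntegral γ (fun u => (a u * x + b u) ^ 2) :=
      arcIntegral_nonneg fun u => sq_nonneg _
    have h2 : (fun u => (a u * x + b u) ^ 2)
        = fun u => (x * x) * a u ^ 2 + (2 * x) * (a u * b u) + b u ^ 2 := by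
      funext u; ring
    rw [h2, hγ.arcIntegral_add (by fun_prop) (by fun_prop),
      hγ.arcIntegral_add (by fun_prop) (by fun_prop), arcIntegral_const_mul,
      arcIntegral_const_mul] at h1
    linarith
  have := discrim_le_zero h
  rw [discrim] at this
  linarith

theorem sq_arcIntegral_abs_le (hγ : IsLoop γ) {a : ℝ → ℝ} (ha : Continuous a) :
    arcIntegral γ (fun u => |a u|) ^ 2 ≤ length γ * arcIntegral γ (fun u => a u ^ 2) := by
  have := hγ.sq_arcIntegral_mul_le (a := fun _ => 1) continuous_const ha.abs
  simpa [length] using this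

/-- A function varies over a period by at most the integral of a bound for its derivative. -/
theorem norm_sub_le_arcIntegral (hγ : IsLoop γ) {g g' : ℝ → E} {b : ℝ → ℝ} (hb : Continuous b)
    (hg : ∀ u, HasDerivAt g (g' u) u) (hbd : ∀ u, ‖g' u‖ ≤ b u * ‖deriv γ u‖)
    {x y : ℝ} (hx : x ∈ Set.Icc (0 : ℝ) 1) (hy : y ∈ Set.Icc (0 : ℝ) 1) :
    ‖g y - g x‖ ≤ arcIntegral γ b := by
  wlog hxy : x ≤ y generalizing x y
  · rw [norm_sub_rev]; exact this hy hx (not_le.1 hxy).le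
  have hcont : Continuous fun u => b u * ‖deriv γ u‖ := hb.mul hγ.continuous_speed
  have h0 : ∀ u, 0 ≤ b u * ‖deriv γ u‖ := fun u => (norm_nonneg _).trans (hbd u)
  have h1 : ‖g y - g x‖ ≤ ∫ u in x..y, b u * ‖deriv γ u‖ := by
    have := image_norm_le_of_norm_deriv_right_le_deriv_boundary' (a := x) (b := y)
      (f := fun u => g u - g x) (f' := g') (B := fun z => ∫ u in x..z, b u * ‖deriv γ u‖)
      (B' := fun z => b z * ‖deriv γ z‖)
      (fun z _ => ((hg z).continuousAt.sub continuousAt_const).continuousWithinAt)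
      (fun z _ => ((hg z).sub_const _).hasDerivWithinAt) (by simp)
      (fun z _ => (hcont.integral_hasStrictDerivAt x z).hasDerivAt.continuousAt.continuousWithinAt)
      (fun z _ => (hcont.integral_hasStrictDerivAt x z).hasDerivAt.hasDerivWithinAt)
      (fun z _ => hbd z)
    exact this ⟨hxy, le_rfl⟩
  refine h1.trans ?_
  exact intervalIntegral.integral_mono_interval hx.1 hxy hy.2
    (Filter.Eventually.of_forall h0) (hcont.intervalIntegrable _ _)

/-- A one-dimensional Sobolev inequality: no value differs from any other, hence from the mean, by
more than the total variation. -/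
theorem abs_le_of_arcDeriv (hγ : IsLoop γ) {w : ℝ → ℝ} (hw : ContDiff ℝ ∞ w)
    {x : ℝ} (hx : x ∈ Set.Icc (0 : ℝ) 1) :
    |w x| ≤ |arcIntegral γ w| / length γ + arcIntegral γ (fun u => |arcDeriv γ w u|) := by
  have hL := hγ.length_pos
  set N := arcIntegral γ (fun u => |arcDeriv γ w u|) with hN
  have hb : Continuous (fun u => |arcDeriv γ w u|) := (hγ.contDiff_arcDeriv hw).continuous.abs
  have h1 : ∀ u ∈ Set.Icc (0 : ℝ) 1, |w x - w u| ≤ N := fun u hu =>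
    hγ.norm_sub_le_arcIntegral hb (fun u => (hw.differentiable (by simp) u).hasDerivAt)
      (fun u => by
        rw [hγ.deriv_eq w u, norm_smul, norm_norm, mul_comm, Real.norm_eq_abs]) hu hx
  have h2 := hγ.abs_arcIntegral_le (g := fun u => w x - w u) (h := fun _ => N)
    (continuous_const.sub hw.continuous) continuous_const h1
  rw [hγ.arcIntegral_sub continuous_const hw.continuous, arcIntegral_const, arcIntegral_const] at h2
  have h3 : |w x| * length γ ≤ |arcIntegral γ w| + N * length γ := by
    rw [← abs_of_pos hL, ← abs_mul, abs_of_pos hL]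
    have := abs_sub_abs_le_abs_sub (w x * length γ) (arcIntegral γ w)
    linarith
  rw [div_add' _ _ _ hL.ne', le_div_iff₀ hL]
  exact h3

end IsLoop

end Loop

end PlaneCurve

/-! ### Total curvature, area and isoperimetric deficit of a closed curve -/

namespace PlaneCurve

section Loop

variable {γ : ℝ → ℂ}

namespace IsLoop

open ComplexConjugate

/-- Arc length measured from `u = 0`. -/
theorem exists_arcLength (hγ : IsLoop γ) : ∃ s : ℝ → ℝ,
    (∀ u, HasDerivAt s ‖deriv γ u‖ u) ∧ s 0 = 0 ∧ s 1 = length γ :=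
  ⟨fun u => ∫ x in (0 : ℝ)..u, ‖deriv γ x‖,
    fun u => (hγ.continuous_speed.integral_hasStrictDerivAt 0 u).hasDerivAt, by simp,
    by simp [length, arcIntegral]⟩

/-- The total curvature is `2πn` for a curve of rotation number `n`. -/
theorem arcIntegral_curvature (hγ : IsLoop γ) {n : ℤ} (h : HasRotationNumber γ n) :
    arcIntegral γ (curvature γ) = 2 * Real.pi * n := by
  obtain ⟨θ, hθ, hT, hn⟩ := h
  set g : ℝ → ℝ := fun u => curvature γ u * ‖deriv γ u‖ with hg
  have hgc : Continuous g := hγ.contDiff_curvature.continuous.mul hγ.continuous_speed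
  set φ : ℝ → ℝ := fun u => ∫ x in (0 : ℝ)..u, g x with hφ
  have hφd : ∀ u, HasDerivAt φ (g u) u := fun u => (hgc.integral_hasStrictDerivAt 0 u).hasDerivAt
  -- The integrated curvature `φ` is itself an angle function up to a constant: rotating the tangent
  -- back by `φ` gives a constant vector.
  have h1 : ∀ u, HasDerivAt (fun u => Complex.exp (-(φ u * Complex.I)) * tangent γ u) 0 u := by
    intro u
    have := (((hφd u).ofReal_comp.mul_const Complex.I).neg.cexp).mul (hγ.hasDerivAt_tangent u)
    refine this.congr_deriv ?_
    simp only [hg]; push_cast; ring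
  have h2 : ∀ u, Complex.exp (-(φ u * Complex.I)) * tangent γ u = tangent γ 0 := by
    intro u
    have := is_const_of_deriv_eq_zero (fun u => (h1 u).differentiableAt) (fun u => (h1 u).deriv) u 0
    simpa [hφ] using this
  have h3 : ∀ u, ∃ m : ℤ, θ u - φ u - θ 0 = m * (2 * Real.pi) := by
    intro u
    have h4 := h2 u
    rw [hT, hT, ← Complex.exp_add, Complex.exp_eq_exp_iff_exists_int] at h4
    obtain ⟨m, hm⟩ := h4
    refine ⟨m, ?_⟩
    have h5 : ((θ u - φ u - θ 0 : ℝ) : ℂ) * Complex.I = (m * (2 * Real.pi) : ℝ) * Complex.I := by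
      push_cast; linear_combination hm
    exact_mod_cast mul_right_cancel₀ Complex.I_ne_zero h5
  choose m hm using h3
  have hpi := Real.pi_pos
  have hφc : Continuous φ := continuous_iff_continuousAt.2 fun u => (hφd u).continuousAt
  have h6 : (fun u => ((m u : ℤ) : ℝ)) = fun u => (θ u - φ u - θ 0) / (2 * Real.pi) := by
    funext u; rw [hm, mul_div_cancel_right₀ _ (by positivity)]
  -- The two angles differ by an integer multiple of `2π` that varies continuously and is therefore
  -- constant.
  have h7 : Continuous (fun u => ((m u : ℤ) : ℝ)) := by rw [h6]; fun_prop
  have h8 : Continuous m := Int.isClosedEmbedding_coe_real.continuous_iff.2 h7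
  have h9 : m 1 = m 0 := PreconnectedSpace.constant inferInstance h8
  have e1 := hm 1
  have e0 := hm 0
  rw [h9] at e1
  have : φ 0 = 0 := by simp [hφ]
  have h10 : arcIntegral γ (curvature γ) = φ 1 := rfl
  rw [h10]
  linarith

theorem periodic_sub (hγ : IsLoop γ) : γ 1 = γ 0 := by
  have := hγ.periodic 0
  rwa [zero_add] at this

/-- A crude bound, which only serves to keep the deficit bounded below along the flow; the sharp
isoperimetric constant is not needed. -/
theorem abs_signedArea_le (hγ : IsLoop γ) : |signedArea γ| ≤ length γ ^ 2 / 2 := by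
  have hL := hγ.length_pos
  have hTc := hγ.contDiff_tangent.continuous
  have hνc := hγ.contDiff_normal.continuous
  have hγc := hγ.smooth.continuous
  -- The normal times the speed is the derivative of `iγ`, so it integrates to zero and the base
  -- point can be moved to `γ 0`.
  have h0 : arcIntegral γ (fun u => inner ℝ (γ 0) (normal γ u)) = 0 := by
    have h1 : ∀ u, HasDerivAt (fun u => inner ℝ (γ 0) (Complex.I * γ u))
        (inner ℝ (γ 0) (normal γ u) * ‖deriv γ u‖) u := by
      intro u
      have := (hasDerivAt_const u (γ 0)).inner ℝ ((hγ.hasDerivAt u).const_mul Complex.I)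
      refine this.congr_deriv ?_
      rw [inner_zero_left, add_zero, normal, ← Complex.real_smul, mul_smul_comm, inner_smul_right,
        mul_comm]
    rw [arcIntegral, intervalIntegral.integral_eq_sub_of_hasDerivAt (fun u _ => h1 u)
      (hγ.intervalIntegrable (by fun_prop) _ _), hγ.periodic_sub, sub_self]
  have h1 : arcIntegral γ (fun u => inner ℝ (γ u) (normal γ u))
      = arcIntegral γ (fun u => inner ℝ (γ u - γ 0) (normal γ u)) := by
    simp only [inner_sub_left]
    rw [hγ.arcIntegral_sub (by fun_prop) (by fun_prop), h0, sub_zero]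
  have h2 : ∀ u ∈ Set.Icc (0 : ℝ) 1, |inner ℝ (γ u - γ 0) (normal γ u)| ≤ length γ := by
    intro u hu
    refine (abs_real_inner_le_norm _ _).trans ?_
    rw [hγ.norm_normal, mul_one]
    exact hγ.norm_sub_le_arcIntegral (b := fun _ => 1) continuous_const hγ.hasDerivAt
      (fun u => by simp [hγ.norm_tangent]) (by simp) hu
  have h3 := hγ.abs_arcIntegral_le (h := fun _ => length γ) (by fun_prop) continuous_const h2
  rw [arcIntegral_const, ← h1] at h3
  rw [signedArea, abs_mul, show |-(1 / 2 : ℝ)| = 1 / 2 by norm_num [abs_of_pos]]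
  linarith

/-- The isoperimetric deficit is at most `L³ ∫ (κ - 2π/L)² ds`. -/
theorem abs_deficit_le (hγ : IsLoop γ) :
    |length γ ^ 2 - 4 * Real.pi * signedArea γ| ≤ length γ ^ 3 *
      arcIntegral γ (fun u => (curvature γ u - 2 * Real.pi / length γ) ^ 2) := by
  have hL := hγ.length_pos
  have hpi := Real.pi_pos
  obtain ⟨s, hs, hs0, hs1⟩ := hγ.exists_arcLength
  set κ₀ : ℝ := 2 * Real.pi / length γ with hκ₀
  have hκ₀0 : (κ₀ : ℂ) ≠ 0 := by
    rw [Complex.ofReal_ne_zero, hκ₀]; positivity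
  have hTc := hγ.contDiff_tangent.continuous
  have hνc := hγ.contDiff_normal.continuous
  have hγc := hγ.smooth.continuous
  have hκc := hγ.contDiff_curvature.continuous
  have hvc := hγ.continuous_speed
  set b : ℝ → ℝ := fun u => |curvature γ u - κ₀| with hb
  have hbc : Continuous b := by fun_prop
  set N := arcIntegral γ b with hN
  -- This undoes the rotation of the tangent of a circle of the same length; it closes up because `L
  -- κ₀ = 2π`. For such a circle both `g` and `h` below are constant.
  set e : ℝ → ℂ := fun u => Complex.exp (-(s u * κ₀ * Complex.I)) with he
  have hed : ∀ u, HasDerivAt e (-(‖deriv γ u‖ * κ₀ * Complex.I) * e u) u := by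
    intro u
    have := ((((hs u).ofReal_comp.mul_const (κ₀ : ℂ)).mul_const Complex.I).neg).cexp
    refine this.congr_deriv ?_
    simp only [he, Pi.neg_apply]; ring
  have hec : Continuous e := continuous_iff_continuousAt.2 fun u => (hed u).continuousAt
  have hen : ∀ u, ‖e u‖ = 1 := by
    intro u
    have : e u = Complex.exp ((-(s u * κ₀) : ℝ) * Complex.I) := by
      simp only [he]; push_cast; ring_nf
    rw [this, Complex.norm_exp_ofReal_mul_I]
  have hee : ∀ u, conj (e u) * e u = 1 := by
    intro u; rw [Complex.conj_mul', hen]; norm_num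
  have he0 : e 0 = 1 := by simp [he, hs0]
  have he1 : e 1 = 1 := by
    have : e 1 = Complex.exp (-(2 * Real.pi * Complex.I)) := by
      simp only [he]
      congr 2
      have : s 1 * κ₀ = 2 * Real.pi := by rw [hs1, hκ₀]; field_simp
      rw [← Complex.ofReal_mul, this]; push_cast; ring
    rw [this, Complex.exp_neg, Complex.exp_two_pi_mul_I, inv_one]
  have hTT : ∀ u, conj (tangent γ u) * tangent γ u = 1 := by
    intro u; rw [Complex.conj_mul', hγ.norm_tangent]; norm_num
  -- the two functions whose increments are controlled by the curvature deviation
  set g : ℝ → ℂ := fun u => e u * tangent γ u with hg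
  set h : ℝ → ℂ := fun u => tangent γ u - Complex.I * κ₀ * γ u with hh
  have hgd : ∀ u, HasDerivAt g
      (‖deriv γ u‖ * ((curvature γ u - κ₀ : ℝ) * (Complex.I * g u))) u := by
    intro u
    refine ((hed u).mul (hγ.hasDerivAt_tangent u)).congr_deriv ?_
    simp only [hg]; push_cast; ring
  have hhd : ∀ u, HasDerivAt h
      (‖deriv γ u‖ * ((curvature γ u - κ₀ : ℝ) * (Complex.I * tangent γ u))) u := by
    intro u
    refine ((hγ.hasDerivAt_tangent u).sub
      ((hγ.hasDerivAt u).const_mul (Complex.I * κ₀))).congr_deriv ?_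
    push_cast; ring
  have hgN : ∀ u ∈ Set.Icc (0 : ℝ) 1, ‖g u - g 0‖ ≤ N := fun u hu =>
    hγ.norm_sub_le_arcIntegral hbc hgd
      (fun u => by simp [hg, hen, hγ.norm_tangent, hb, mul_comm,
        -Complex.ofReal_sub]) (by simp) hu
  have hhN : ∀ u ∈ Set.Icc (0 : ℝ) 1, ‖h u - h 0‖ ≤ N := fun u hu =>
    hγ.norm_sub_le_arcIntegral hbc hhd
      (fun u => by simp [hγ.norm_tangent, hb, mul_comm,
        -Complex.ofReal_sub]) (by simp) hu
  have hgc : Continuous g := hec.mul hTc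
  have hhc : Continuous h := hTc.sub (continuous_const.mul hγc)
  -- `P` is quadratic in the curvature deviation. Expanding the product, `conj g * e * h = conj T *
  -- (T - iκ₀γ)` has real part `1 + κ₀ ⟨γ, ν⟩`, and the three terms involving `g 0` or `h 0` are
  -- exact derivatives, collected in `Φ`.
  set P : ℝ → ℝ := fun u => (conj (g u - g 0) * e u * (h u - h 0)).re with hP
  have hPc : Continuous P :=
    Complex.continuous_re.comp (((Complex.continuous_conj.comp (hgc.sub continuous_const)).mul
      hec).mul (hhc.sub continuous_const))
  have hPN : ∀ u ∈ Set.Icc (0 : ℝ) 1, |P u| ≤ N ^ 2 := by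
    intro u hu
    refine (Complex.abs_re_le_norm _).trans ?_
    rw [norm_mul, norm_mul, hen, mul_one, RCLike.norm_conj, sq]
    exact mul_le_mul (hgN u hu) (hhN u hu) (norm_nonneg _) ((norm_nonneg _).trans (hgN u hu))
  -- the integrand differs from `P` by an exact derivative
  set Φ : ℝ → ℂ := fun u => conj (γ u) * h 0 + conj (g 0) * (e u * γ u)
    + conj (g 0) * h 0 * (e u * (-Complex.I / κ₀)) with hΦ
  have hΦd : ∀ u, HasDerivAt Φ (conj (‖deriv γ u‖ * tangent γ u) * h 0
      + conj (g 0) * ((-(‖deriv γ u‖ * κ₀ * Complex.I) * e u) * γ u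
        + e u * (‖deriv γ u‖ * tangent γ u))
      + conj (g 0) * h 0 * ((-(‖deriv γ u‖ * κ₀ * Complex.I) * e u) * (-Complex.I / κ₀))) u := by
    intro u
    have hconj : HasDerivAt (fun u => conj (γ u)) (conj (‖deriv γ u‖ * tangent γ u)) u := by
      have := (Complex.conjCLE.toContinuousLinearMap.hasFDerivAt (x := γ u)).comp_hasDerivAt u
        (hγ.hasDerivAt u)
      exact this
    exact ((hconj.mul_const _).add (((hed u).mul (hγ.hasDerivAt u)).const_mul _)).add
      (((hed u).mul_const _).const_mul _)
  have hΦr : ∀ u, HasDerivAt (fun u => (Φ u).re)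
      ((1 + κ₀ * inner ℝ (γ u) (normal γ u) - P u) * ‖deriv γ u‖) u := by
    intro u
    have := (Complex.reCLM.hasFDerivAt (x := Φ u)).comp_hasDerivAt u (hΦd u)
    refine this.congr_deriv ?_
    have key : conj (‖deriv γ u‖ * tangent γ u) * h 0
      + conj (g 0) * ((-(‖deriv γ u‖ * κ₀ * Complex.I) * e u) * γ u
        + e u * (‖deriv γ u‖ * tangent γ u))
      + conj (g 0) * h 0 * ((-(‖deriv γ u‖ * κ₀ * Complex.I) * e u) * (-Complex.I / κ₀))
      = (‖deriv γ u‖ : ℂ) * (1 - κ₀ * (conj (tangent γ u) * (Complex.I * γ u))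
        - conj (g u - g 0) * e u * (h u - h 0)) := by
      have e1 : (-(‖deriv γ u‖ * κ₀ * Complex.I) * e u) * (-Complex.I / κ₀)
          = - (‖deriv γ u‖ * e u) := by
        field_simp
        rw [Complex.I_sq]; ring
      have e2 := hee u
      have e3 := hTT u
      rw [e1]
      simp only [hg, hh, map_mul, map_sub, Complex.conj_ofReal]
      linear_combination ((‖deriv γ u‖ : ℂ) * conj (tangent γ u)
        * (tangent γ u - Complex.I * κ₀ * γ u - (tangent γ 0 - Complex.I * κ₀ * γ 0))) * e2 + (‖deriv γ u‖ : ℂ) * e3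
    rw [key]
    rw [Complex.reCLM_apply, Complex.re_ofReal_mul, mul_comm]
    congr 1
    simp only [hP, Complex.sub_re, Complex.one_re, normal, Complex.inner, Complex.re_ofReal_mul]
    simp only [Complex.mul_re, Complex.mul_im, Complex.conj_re, Complex.conj_im, Complex.I_re,
      Complex.I_im]
    ring
  have hint := intervalIntegral.integral_eq_sub_of_hasDerivAt (fun u _ => hΦr u)
    (hγ.intervalIntegrable (g := fun u => 1 + κ₀ * inner ℝ (γ u) (normal γ u) - P u)
      (by fun_prop) 0 1)
  have hΦ1 : Φ 1 = Φ 0 := by simp only [hΦ, hγ.periodic_sub, he0, he1]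
  rw [hΦ1, sub_self] at hint
  have hint' : arcIntegral γ (fun u => 1 + κ₀ * inner ℝ (γ u) (normal γ u) - P u) = 0 := hint
  rw [hγ.arcIntegral_sub (by fun_prop) hPc, hγ.arcIntegral_add (by fun_prop) (by fun_prop),
    arcIntegral_const_mul, arcIntegral_const] at hint'
  -- Integration over a period kills `Φ` and leaves `∫ P ds = L - 2κ₀A` with `κ₀ = 2π/L`.
  have hD : length γ ^ 2 - 4 * Real.pi * signedArea γ = length γ * arcIntegral γ P := by
    have : arcIntegral γ P = length γ
        + κ₀ * arcIntegral γ (fun u => inner ℝ (γ u) (normal γ u)) := by linarith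
    rw [this, signedArea, hκ₀]; field_simp; ring
  have hPI := hγ.abs_arcIntegral_le hPc continuous_const hPN
  rw [arcIntegral_const] at hPI
  have hCS := hγ.sq_arcIntegral_abs_le (a := fun u => curvature γ u - κ₀) (by fun_prop)
  rw [hD, abs_mul, abs_of_pos hL]
  calc length γ * |arcIntegral γ P| ≤ length γ * (N ^ 2 * length γ) := by gcongr
    _ ≤ length γ * (length γ * arcIntegral γ (fun u => (curvature γ u - κ₀) ^ 2) * length γ) := by
      gcongr
    _ = _ := by ring

end IsLoop

end Loop

end PlaneCurve

/-! ### Periodic families smooth up to the initial time -/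

namespace PlaneCurve

section Family

variable {E : Type*} [NormedAddCommGroup E] [NormedSpace ℝ E]

/-- A family of `1`-periodic functions `G · t`, jointly smooth up to the initial time `t = 0`. -/
structure IsFamily (G : ℝ → ℝ → E) : Prop where
  smooth : ContDiffOn ℝ ∞ (fun p : ℝ × ℝ => G p.1 p.2) (Set.univ ×ˢ Set.Ici 0)
  periodic : ∀ t, 0 ≤ t → Function.Periodic (fun u => G u t) 1

/-- The derivative of a family in the space variable. -/
noncomputable def spaceDeriv (G : ℝ → ℝ → E) (u t : ℝ) : E := deriv (fun v => G v t) u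

/-- The derivative of a family in the time variable. -/
noncomputable def timeDeriv (G : ℝ → ℝ → E) (u t : ℝ) : E := deriv (fun τ => G u τ) t

namespace IsFamily

variable {G H : ℝ → ℝ → E}

theorem slice (hG : IsFamily G) {t : ℝ} (ht : 0 ≤ t) : ContDiff ℝ ∞ (fun u => G u t) :=
  hG.smooth.comp_contDiff (f := fun u : ℝ => (u, t)) (by fun_prop) fun u => by simp [ht]

theorem hasDerivAt_space (hG : IsFamily G) {t : ℝ} (ht : 0 ≤ t) (u : ℝ) :
    HasDerivAt (fun v => G v t) (spaceDeriv G u t) u :=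
  ((hG.slice ht).differentiable (by simp) u).hasDerivAt

/-- The space direction is tangent to the boundary `t = 0`, so the derivative within the half-plane
in the direction `(1, 0)` is the ordinary one even there. -/
theorem spaceDeriv (hG : IsFamily G) : IsFamily (spaceDeriv G) where
  periodic t ht := (hG.periodic t ht).deriv'
  smooth := by
    have hS : UniqueDiffOn ℝ ((Set.univ : Set ℝ) ×ˢ Set.Ici (0 : ℝ)) :=
      uniqueDiffOn_univ.prod (uniqueDiffOn_Ici 0)
    have h1 := (hG.smooth.fderivWithin hS (m := ∞) (by simp)).clm_apply
      (contDiffOn_const (c := ((1 : ℝ), (0 : ℝ))))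
    refine h1.congr fun p hp => ?_
    have h2 := (hG.smooth.differentiableOn (by simp) p hp).hasFDerivWithinAt
    have h3 : HasDerivAt (fun v : ℝ => (v, p.2)) ((1 : ℝ), (0 : ℝ)) p.1 :=
      (hasDerivAt_id p.1).prodMk (hasDerivAt_const _ _)
    have h4 : ∀ v : ℝ, (v, p.2) ∈ (Set.univ : Set ℝ) ×ˢ Set.Ici (0 : ℝ) := fun v => ⟨trivial, hp.2⟩
    exact (HasFDerivWithinAt.comp_hasDerivAt p.1 h2 h3 (Filter.Eventually.of_forall h4)).deriv

theorem contDiffAt (hG : IsFamily G) {t : ℝ} (ht : 0 < t) (u : ℝ) :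
    ContDiffAt ℝ ∞ (fun p : ℝ × ℝ => G p.1 p.2) (u, t) :=
  hG.smooth.contDiffAt (prod_mem_nhds Filter.univ_mem (Ici_mem_nhds ht))

theorem hasDerivAt_time' (hG : IsFamily G) {t : ℝ} (ht : 0 < t) (u : ℝ) :
    HasDerivAt (fun τ => G u τ) (fderiv ℝ (fun p : ℝ × ℝ => G p.1 p.2) (u, t) (0, 1)) t :=
  HasFDerivAt.comp_hasDerivAt t
    ((hG.contDiffAt ht u).differentiableAt (by simp)).hasFDerivAt
    ((hasDerivAt_const t u).prodMk (hasDerivAt_id' t))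

theorem hasDerivAt_space' (hG : IsFamily G) {t : ℝ} (ht : 0 < t) (u : ℝ) :
    HasDerivAt (fun v => G v t) (fderiv ℝ (fun p : ℝ × ℝ => G p.1 p.2) (u, t) (1, 0)) u :=
  HasFDerivAt.comp_hasDerivAt (l := fun p : ℝ × ℝ => G p.1 p.2) (f := fun v => (v, t)) u
    ((hG.contDiffAt ht u).differentiableAt (by simp)).hasFDerivAt
    ((hasDerivAt_id' u).prodMk (hasDerivAt_const u t))

theorem hasDerivAt_time (hG : IsFamily G) {t : ℝ} (ht : 0 < t) (u : ℝ) :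
    HasDerivAt (fun τ => G u τ) (timeDeriv G u t) t :=
  (hG.hasDerivAt_time' ht u).differentiableAt.hasDerivAt

/-- Space and time derivatives commute. -/
theorem hasDerivAt_timeDeriv (hG : IsFamily G) {t : ℝ} (ht : 0 < t) (u : ℝ) :
    HasDerivAt (fun v => timeDeriv G v t) (timeDeriv (PlaneCurve.spaceDeriv G) u t) u := by
  set f : ℝ × ℝ → E := fun p => G p.1 p.2 with hf
  have hc := hG.contDiffAt ht u
  have hsymm : IsSymmSndFDerivAt ℝ f (u, t) := hc.isSymmSndFDerivAt (by simpa using ENat.LEInfty.out)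
  have h2 : HasFDerivAt (fderiv ℝ f) (fderiv ℝ (fderiv ℝ f) (u, t)) (u, t) :=
    ((hc.fderiv_right (m := ∞) (by simp)).differentiableAt (by simp)).hasFDerivAt
  have h3 : HasDerivAt (fun v => fderiv ℝ f (v, t) (0, 1))
      (fderiv ℝ (fderiv ℝ f) (u, t) (1, 0) (0, 1)) u := by
    have := (HasFDerivAt.comp_hasDerivAt u h2 ((hasDerivAt_id' u).prodMk (hasDerivAt_const u t)))
    simpa using this.clm_apply (hasDerivAt_const u ((0 : ℝ), (1 : ℝ)))
  have h4 : HasDerivAt (fun τ => fderiv ℝ f (u, τ) (1, 0))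
      (fderiv ℝ (fderiv ℝ f) (u, t) (0, 1) (1, 0)) t := by
    have := (HasFDerivAt.comp_hasDerivAt t h2 ((hasDerivAt_const t u).prodMk (hasDerivAt_id' t)))
    simpa using this.clm_apply (hasDerivAt_const t ((1 : ℝ), (0 : ℝ)))
  have h5 : (fun v => timeDeriv G v t) = fun v => fderiv ℝ f (v, t) (0, 1) :=
    funext fun v => (hG.hasDerivAt_time' ht v).deriv
  have h6 : timeDeriv (PlaneCurve.spaceDeriv G) u t
      = fderiv ℝ (fderiv ℝ f) (u, t) (0, 1) (1, 0) := by
    refine (h4.congr_of_eventuallyEq ?_).deriv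
    filter_upwards [Ioi_mem_nhds ht] with τ hτ
    exact (hG.hasDerivAt_space' hτ u).deriv
  rw [h5, h6, hsymm.eq]
  exact h3

theorem continuousOn_timeDeriv (hG : IsFamily G) :
    ContinuousOn (fun p : ℝ × ℝ => timeDeriv G p.1 p.2) (Set.univ ×ˢ Set.Ioi 0) := by
  intro p hp
  have h := ((hG.contDiffAt hp.2 p.1).fderiv_right (m := 0) (by simp)).continuousAt.clm_apply
    (continuousAt_const (y := ((0 : ℝ), (1 : ℝ))))
  refine h.continuousWithinAt.congr (fun q hq => ?_) ?_
  · exact (hG.hasDerivAt_time' hq.2 q.1).deriv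
  · exact (hG.hasDerivAt_time' hp.2 p.1).deriv

theorem continuous_timeDeriv (hG : IsFamily G) {t : ℝ} (ht : 0 < t) :
    Continuous (fun u => timeDeriv G u t) :=
  hG.continuousOn_timeDeriv.comp_continuous (f := fun u : ℝ => (u, t)) (by fun_prop)
    fun u => by simp [ht]

theorem hasDerivAt_integral [CompleteSpace E] (hG : IsFamily G) {t : ℝ} (ht : 0 < t) :
    HasDerivAt (fun τ => ∫ u in (0 : ℝ)..1, G u τ) (∫ u in (0 : ℝ)..1, timeDeriv G u t) t := by
  -- The time window `[t/2, 2t]` is a neighbourhood of `t` that avoids the initial time, where the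
  -- two-sided time derivative is not controlled.
  obtain ⟨C, hC⟩ := (isCompact_Icc (a := (0 : ℝ)) (b := 1)).prod
    (isCompact_Icc (a := t / 2) (b := 2 * t)) |>.exists_bound_of_continuousOn
    (hG.continuousOn_timeDeriv.mono fun p hp => ⟨trivial, lt_of_lt_of_le (half_pos ht) hp.2.1⟩)
  have hpos : ∀ τ ∈ Set.Icc (t / 2) (2 * t), 0 < τ := fun τ hτ => lt_of_lt_of_le (half_pos ht) hτ.1
  refine (intervalIntegral.hasDerivAt_integral_of_dominated_loc_of_deriv_le
    (F := fun τ u => G u τ) (F' := fun τ u => timeDeriv G u τ) (bound := fun _ => C)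
    (s := Set.Icc (t / 2) (2 * t)) (Icc_mem_nhds (by linarith) (by linarith)) ?_
    ((hG.slice ht.le).continuous.intervalIntegrable _ _)
    (hG.continuous_timeDeriv ht).aestronglyMeasurable ?_ (by simp) ?_).2
  · filter_upwards [Ioi_mem_nhds ht] with τ hτ
    exact (hG.slice (le_of_lt hτ)).continuous.aestronglyMeasurable
  · refine Filter.Eventually.of_forall fun u hu τ hτ => hC (u, τ) ⟨?_, hτ⟩
    rw [Set.uIoc_of_le zero_le_one] at hu
    exact Set.Ioc_subset_Icc_self hu
  · exact Filter.Eventually.of_forall fun u _ τ hτ => hG.hasDerivAt_time (hpos τ hτ) u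

theorem continuousOn_integral [CompleteSpace E] (hG : IsFamily G) :
    ContinuousOn (fun τ => ∫ u in (0 : ℝ)..1, G u τ) (Set.Ici 0) := by
  have h1 : Continuous (Function.uncurry fun τ u => G u (max τ 0)) :=
    hG.smooth.continuousOn.comp_continuous
      (f := fun p : ℝ × ℝ => (p.2, max p.1 0)) (by fun_prop) fun p => by simp
  have h2 := intervalIntegral.continuous_parametric_intervalIntegral_of_continuous'
    (μ := MeasureTheory.volume) h1 0 1
  refine h2.continuousOn.congr fun τ hτ => ?_
  simp only [max_eq_left (Set.mem_Ici.1 hτ)]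

theorem add (hG : IsFamily G) (hH : IsFamily H) : IsFamily (fun u t => G u t + H u t) where
  smooth := hG.smooth.add hH.smooth
  periodic t ht u := congrArg₂ (· + ·) (hG.periodic t ht u) (hH.periodic t ht u)

theorem const (c : E) : IsFamily (fun _ _ => c) where
  smooth := contDiffOn_const
  periodic _ _ _ := rfl

theorem smul {g : ℝ → ℝ → ℝ} (hg : IsFamily g) (hH : IsFamily H) :
    IsFamily (fun u t => g u t • H u t) where
  smooth := hg.smooth.smul hH.smooth
  periodic t ht u := congrArg₂ (· • ·) (hg.periodic t ht u) (hH.periodic t ht u)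

theorem clm {F : Type*} [NormedAddCommGroup F] [NormedSpace ℝ F] (hG : IsFamily G) (A : E →L[ℝ] F) :
    IsFamily (fun u t => A (G u t)) where
  smooth := A.contDiff.comp_contDiffOn hG.smooth
  periodic t ht u := congrArg A (hG.periodic t ht u)

theorem mul {g h : ℝ → ℝ → ℝ} (hg : IsFamily g) (hh : IsFamily h) :
    IsFamily (fun u t => g u t * h u t) := hg.smul hh

theorem inner {g h : ℝ → ℝ → ℂ} (hg : IsFamily g) (hh : IsFamily h) :
    IsFamily (fun u t => (inner ℝ (g u t) (h u t) : ℝ)) where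
  smooth := hg.smooth.inner ℝ hh.smooth
  periodic t ht u := congrArg₂ (fun x y : ℂ => (Inner.inner ℝ x y : ℝ))
    (hg.periodic t ht u) (hh.periodic t ht u)

end IsFamily

end Family

end PlaneCurve

/-! ### Evolution equations of speed, tangent and curvature -/

namespace PlaneCurve

section Flow

variable {E : Type*} [NormedAddCommGroup E] [NormedSpace ℝ E] {f : ℝ → ℝ → ℂ} {t : ℝ}

/-- The curve `f · t` of a family. -/
def curveAt (f : ℝ → ℝ → ℂ) (t : ℝ) : ℝ → ℂ := fun u => f u t

/-- The arc length derivative of a family `G` along a family of curves. -/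
noncomputable def arcD (f : ℝ → ℝ → ℂ) (G : ℝ → ℝ → E) (u t : ℝ) : E :=
  arcDeriv (curveAt f t) (fun v => G v t) u

/-- The speed `|∂ᵤ f|` of a family of curves. -/
noncomputable def speed (f : ℝ → ℝ → ℂ) (u t : ℝ) : ℝ := ‖deriv (curveAt f t) u‖

/-- The unit tangents of a family of curves. -/
noncomputable def tang (f : ℝ → ℝ → ℂ) (u t : ℝ) : ℂ := tangent (curveAt f t) u

/-- The signed curvatures of a family of curves. -/
noncomputable def curv (f : ℝ → ℝ → ℂ) (u t : ℝ) : ℝ := curvature (curveAt f t) u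

/-- The integral of a family along a family of curves. -/
noncomputable def arcInt (f : ℝ → ℝ → ℂ) (G : ℝ → ℝ → ℝ) (t : ℝ) : ℝ :=
  arcIntegral (curveAt f t) (fun u => G u t)

/-- The normal speed `κ - (1/2π) ∫ κ² ds` of the flow. -/
noncomputable def normalSpeed (f : ℝ → ℝ → ℂ) (u t : ℝ) : ℝ :=
  curv f u t - 1 / (2 * Real.pi) * arcInt f (fun u t => curv f u t ^ 2) t

namespace IsGlobalLengthPreservingFlow

theorem family (hf : IsGlobalLengthPreservingFlow f) : IsFamily f := ⟨hf.smooth, hf.periodic⟩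

theorem loop (hf : IsGlobalLengthPreservingFlow f) (ht : 0 ≤ t) : IsLoop (curveAt f t) :=
  ⟨hf.family.slice ht, hf.periodic t ht, hf.immersed t ht⟩

theorem family_speed (hf : IsGlobalLengthPreservingFlow f) : IsFamily (speed f) where
  smooth := hf.family.spaceDeriv.smooth.norm ℝ fun p hp => hf.immersed p.2 hp.2 p.1
  periodic t ht u := congrArg norm (hf.family.spaceDeriv.periodic t ht u)

theorem speed_pos (hf : IsGlobalLengthPreservingFlow f) (ht : 0 ≤ t) (u : ℝ) : 0 < speed f u t :=
  (hf.loop ht).speed_pos u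

theorem family_arcD (hf : IsGlobalLengthPreservingFlow f) {G : ℝ → ℝ → E} (hG : IsFamily G) :
    IsFamily (arcD f G) where
  smooth := (hf.family_speed.smooth.inv fun p hp => (hf.speed_pos hp.2 p.1).ne').smul
    hG.spaceDeriv.smooth
  periodic t ht := (hf.loop ht).periodic_arcDeriv (hG.periodic t ht)

theorem family_tang (hf : IsGlobalLengthPreservingFlow f) : IsFamily (tang f) :=
  hf.family_arcD hf.family

theorem family_curv (hf : IsGlobalLengthPreservingFlow f) : IsFamily (curv f) :=
  (hf.family_arcD hf.family_tang).inner
    (hf.family_tang.clm (ContinuousLinearMap.mul ℝ ℂ Complex.I))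

theorem spaceDeriv_eq (hf : IsGlobalLengthPreservingFlow f) (ht : 0 ≤ t) (G : ℝ → ℝ → E) (u : ℝ) :
    spaceDeriv G u t = speed f u t • arcD f G u t :=
  (hf.loop ht).deriv_eq _ u

theorem hasDerivAt_space (hf : IsGlobalLengthPreservingFlow f) (ht : 0 ≤ t) {G : ℝ → ℝ → E}
    (hG : IsFamily G) (u : ℝ) : HasDerivAt (fun v => G v t) (speed f u t • arcD f G u t) u := by
  rw [← hf.spaceDeriv_eq ht]
  exact hG.hasDerivAt_space ht u

theorem norm_tang (hf : IsGlobalLengthPreservingFlow f) (ht : 0 ≤ t) (u : ℝ) :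
    ‖tang f u t‖ = 1 := (hf.loop ht).norm_tangent u

theorem arcD_tang (hf : IsGlobalLengthPreservingFlow f) (ht : 0 ≤ t) (u : ℝ) :
    arcD f (tang f) u t = curv f u t * (Complex.I * tang f u t) :=
  (hf.loop ht).curvatureVector_eq u

theorem timeDeriv_eq (hf : IsGlobalLengthPreservingFlow f) (ht : 0 < t) (u : ℝ) :
    timeDeriv f u t = normalSpeed f u t * (Complex.I * tang f u t) := by
  have h1 : curvatureVector (curveAt f t) u = curv f u t * (Complex.I * tang f u t) :=
    hf.arcD_tang ht.le u
  have h2 : arcIntegral (curveAt f t) (fun w => ‖curvatureVector (curveAt f t) w‖ ^ 2)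
      = arcInt f (fun u t => curv f u t ^ 2) t := by
    simp only [(hf.loop ht.le).sq_norm_curvatureVector]; rfl
  have h3 := ((hf.flow t ht.le u).hasDerivAt (Ici_mem_nhds ht)).deriv
  refine h3.trans ?_
  change curvatureVector (curveAt f t) u - (1 / (2 * Real.pi) *
    arcIntegral (curveAt f t) (fun w => ‖curvatureVector (curveAt f t) w‖ ^ 2)) •
      (Complex.I * tang f u t) = _
  rw [h1, h2, normalSpeed, Complex.real_smul]
  push_cast; ring

theorem hasDerivAt_normalSpeed (hf : IsGlobalLengthPreservingFlow f) (ht : 0 ≤ t) (u : ℝ) :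
    HasDerivAt (fun v => normalSpeed f v t) (speed f u t * arcD f (curv f) u t) u :=
  (hf.hasDerivAt_space ht hf.family_curv u).sub_const _

theorem timeDeriv_spaceDeriv (hf : IsGlobalLengthPreservingFlow f) (ht : 0 < t) (u : ℝ) :
    timeDeriv (spaceDeriv f) u t = speed f u t * (arcD f (curv f) u t * (Complex.I * tang f u t)
      - normalSpeed f u t * curv f u t * tang f u t) := by
  have h1 := hf.family.hasDerivAt_timeDeriv ht u
  have h2 : (fun v => timeDeriv f v t)
      = fun v => normalSpeed f v t * (Complex.I * tang f v t) :=
    funext (hf.timeDeriv_eq ht)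
  rw [h2] at h1
  have h3 := (hf.hasDerivAt_normalSpeed ht.le u).ofReal_comp.mul
    ((hf.hasDerivAt_space ht.le hf.family_tang u).const_mul Complex.I)
  refine (h1.unique h3).trans ?_
  rw [hf.arcD_tang ht.le, Complex.real_smul]
  push_cast
  linear_combination (speed f u t * normalSpeed f u t * curv f u t * tang f u t : ℂ) * Complex.I_sq

/-- In the derivative of `|∂ᵤf|²` only the tangential part `-Fκ` of `∂ₜ∂ᵤf` survives. -/
theorem hasDerivAt_speed (hf : IsGlobalLengthPreservingFlow f) (ht : 0 < t) (u : ℝ) :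
    HasDerivAt (fun τ => speed f u τ) (-(curv f u t * normalSpeed f u t) * speed f u t) t := by
  have h1 := (hf.family.spaceDeriv.hasDerivAt_time ht u).norm_sq
  have h2 := (hf.family_speed.hasDerivAt_time ht u).pow 2
  have h3 := h1.unique h2
  have h4 : spaceDeriv f u t = speed f u t * tang f u t := by
    rw [hf.spaceDeriv_eq ht.le, Complex.real_smul]; rfl
  have hv := hf.speed_pos ht.le u
  have h5 : inner ℝ (spaceDeriv f u t) (timeDeriv (spaceDeriv f) u t)
      = -(curv f u t * normalSpeed f u t) * speed f u t ^ 2 := by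
    rw [h4, hf.timeDeriv_spaceDeriv ht]
    have h6 : (tang f u t).re * (tang f u t).re + (tang f u t).im * (tang f u t).im = 1 := by
      rw [← Complex.normSq_apply, Complex.normSq_eq_norm_sq, hf.norm_tang ht.le]; norm_num
    generalize tang f u t = T at *
    rw [Complex.inner]
    simp
    linear_combination (-speed f u t ^ 2 * normalSpeed f u t * curv f u t) * h6
  rw [h5] at h3
  have h7 : timeDeriv (speed f) u t = -(curv f u t * normalSpeed f u t) * speed f u t := by
    apply mul_left_cancel₀ hv.ne'
    simp at h3
    linarith
  rw [← h7]
  exact hf.family_speed.hasDerivAt_time ht u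

/-- The commutator of the time derivative and the arc length derivative. -/
theorem hasDerivAt_arcD (hf : IsGlobalLengthPreservingFlow f) (ht : 0 < t) {G : ℝ → ℝ → E}
    (hG : IsFamily G) (u : ℝ) : HasDerivAt (fun τ => arcD f G u τ)
      (arcD f (timeDeriv G) u t + (curv f u t * normalSpeed f u t) • arcD f G u t) t := by
  have h1 := (hf.family_arcD hG).hasDerivAt_time ht u
  have h2 := (hf.hasDerivAt_speed ht u).smul h1
  have h3 := hG.spaceDeriv.hasDerivAt_time ht u
  -- The commutator comes from differentiating `|∂ᵤf| ∂ₛG = ∂ᵤG` in time and exchanging `∂ₜ` with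
  -- `∂ᵤ`.
  have h4 : timeDeriv (spaceDeriv G) u t = speed f u t • arcD f (timeDeriv G) u t := by
    rw [← hf.spaceDeriv_eq ht.le]
    exact (hG.hasDerivAt_timeDeriv ht u).deriv.symm
  have h5 : (fun τ => speed f u τ • arcD f G u τ) =ᶠ[nhds t] fun τ => spaceDeriv G u τ := by
    filter_upwards [Ioi_mem_nhds ht] with τ hτ
    rw [hf.spaceDeriv_eq (le_of_lt hτ)]
  have h6 := h2.unique (h3.congr_of_eventuallyEq h5)
  have hv := hf.speed_pos ht.le u
  have h7 : timeDeriv (arcD f G) u t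
      = arcD f (timeDeriv G) u t + (curv f u t * normalSpeed f u t) • arcD f G u t := by
    apply smul_right_injective E hv.ne'
    simp only
    rw [smul_add, ← h4, ← h6, smul_smul, add_assoc, ← add_smul]
    rw [show -(curv f u t * normalSpeed f u t) * speed f u t
      + speed f u t * (curv f u t * normalSpeed f u t) = 0 by ring, zero_smul, add_zero]
  rw [← h7]
  exact h1

theorem timeDeriv_arcD (hf : IsGlobalLengthPreservingFlow f) (ht : 0 < t) {G : ℝ → ℝ → E}
    (hG : IsFamily G) (u : ℝ) : timeDeriv (arcD f G) u t
      = arcD f (timeDeriv G) u t + (curv f u t * normalSpeed f u t) • arcD f G u t :=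
  (hf.hasDerivAt_arcD ht hG u).deriv

/-- The commutator term `κF T` cancels the tangential part of `∂ₛ∂ₜf`. -/
theorem timeDeriv_tang (hf : IsGlobalLengthPreservingFlow f) (ht : 0 < t) (u : ℝ) :
    timeDeriv (tang f) u t = arcD f (curv f) u t * (Complex.I * tang f u t) := by
  have h1 : timeDeriv (tang f) u t = _ := hf.timeDeriv_arcD ht hf.family u
  have hv := hf.speed_pos ht.le u
  have h2 : arcD f (timeDeriv f) u t = arcD f (curv f) u t * (Complex.I * tang f u t)
      - normalSpeed f u t * curv f u t * tang f u t := by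
    have h3 : speed f u t • arcD f (timeDeriv f) u t = _ :=
      (hf.spaceDeriv_eq ht.le _ u).symm.trans
        ((hf.family.hasDerivAt_timeDeriv ht u).deriv.trans (hf.timeDeriv_spaceDeriv ht u))
    rw [Complex.real_smul] at h3
    exact mul_left_cancel₀ (by exact_mod_cast hv.ne') h3
  have h4 : arcD f f u t = tang f u t := rfl
  rw [h1, h2, h4, Complex.real_smul]
  push_cast; ring

/-- The evolution equation of the curvature. -/
theorem timeDeriv_curv (hf : IsGlobalLengthPreservingFlow f) (ht : 0 < t) (u : ℝ) :
    timeDeriv (curv f) u t = arcD f (arcD f (curv f)) u t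
      + curv f u t ^ 2 * normalSpeed f u t := by
  -- Both sides of `∂ₛT = κ iT` are differentiated in time; the tangential terms `-κ κₛ T` agree,
  -- and comparing the coefficients of `iT` gives the equation.
  have h1 := hf.hasDerivAt_arcD ht hf.family_tang u
  have h2 : (fun τ => arcD f (tang f) u τ) =ᶠ[nhds t]
      fun τ => curv f u τ * (Complex.I * tang f u τ) := by
    filter_upwards [Ioi_mem_nhds ht] with τ hτ
    exact hf.arcD_tang (le_of_lt hτ) u
  have h3 := (hf.family_curv.hasDerivAt_time ht u).ofReal_comp.mul
    ((hf.family_tang.hasDerivAt_time ht u).const_mul Complex.I)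
  have h4 := (h1.congr_of_eventuallyEq h2.symm).unique h3
  have hv := hf.speed_pos ht.le u
  have h5 : arcD f (timeDeriv (tang f)) u t
      = arcD f (arcD f (curv f)) u t * (Complex.I * tang f u t)
        - arcD f (curv f) u t * curv f u t * tang f u t := by
    have h6 : (fun v => timeDeriv (tang f) v t)
        = fun v => arcD f (curv f) v t * (Complex.I * tang f v t) :=
      funext (hf.timeDeriv_tang ht)
    have h7 := (hf.hasDerivAt_space ht.le (hf.family_arcD hf.family_curv) u).ofReal_comp.mul
      ((hf.hasDerivAt_space ht.le hf.family_tang u).const_mul Complex.I)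
    have h8 : speed f u t • arcD f (timeDeriv (tang f)) u t = _ :=
      (hf.spaceDeriv_eq ht.le _ u).symm.trans ((congrFun (congrArg deriv h6) u).trans h7.deriv)
    rw [hf.arcD_tang ht.le, Complex.real_smul, Complex.real_smul, smul_eq_mul] at h8
    have hv' : (speed f u t : ℂ) ≠ 0 := by exact_mod_cast hv.ne'
    apply mul_left_cancel₀ hv'
    rw [h8]
    push_cast
    linear_combination (speed f u t * arcD f (curv f) u t * curv f u t * tang f u t : ℂ)
      * Complex.I_sq
  rw [h5, hf.arcD_tang ht.le, hf.timeDeriv_tang ht, Complex.real_smul] at h4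
  have hT : Complex.I * tang f u t ≠ 0 := by
    refine mul_ne_zero Complex.I_ne_zero fun h => ?_
    have := hf.norm_tang ht.le u
    rw [h, norm_zero] at this
    exact zero_ne_one this
  have h9 : ((timeDeriv (curv f) u t : ℝ) : ℂ) = ((arcD f (arcD f (curv f)) u t
      + curv f u t ^ 2 * normalSpeed f u t : ℝ) : ℂ) := by
    apply mul_right_cancel₀ hT
    push_cast at h4 ⊢
    linear_combination -h4 - (arcD f (curv f) u t * curv f u t * tang f u t : ℂ) * Complex.I_sq
  exact_mod_cast h9

/-! ### Time derivatives of integrals along the flow -/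

/-- The extra term is the variation `-κF ds` of the arc length element. -/
theorem hasDerivAt_arcInt (hf : IsGlobalLengthPreservingFlow f) (ht : 0 < t) {G : ℝ → ℝ → ℝ}
    (hG : IsFamily G) : HasDerivAt (arcInt f G) (arcInt f (fun u t => timeDeriv G u t
      - curv f u t * normalSpeed f u t * G u t) t) t := by
  have h1 := (hG.mul hf.family_speed).hasDerivAt_integral ht
  refine h1.congr_deriv (intervalIntegral.integral_congr fun u _ => ?_)
  refine ((hG.hasDerivAt_time ht u).mul (hf.hasDerivAt_speed ht u)).deriv.trans ?_
  simp only [speed]; ring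

theorem continuousOn_arcInt (hf : IsGlobalLengthPreservingFlow f) {G : ℝ → ℝ → ℝ}
    (hG : IsFamily G) : ContinuousOn (arcInt f G) (Set.Ici 0) :=
  (hG.mul hf.family_speed).continuousOn_integral

end IsGlobalLengthPreservingFlow

end Flow

end PlaneCurve

/-! ### Conserved quantities and growth of the area -/

namespace PlaneCurve

section Monotone

theorem antitoneOn_Ici_of_hasDerivAt {g g' : ℝ → ℝ} (hc : ContinuousOn g (Set.Ici 0))
    (hd : ∀ t, 0 < t → HasDerivAt g (g' t) t) (h : ∀ t, 0 < t → g' t ≤ 0) :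
    AntitoneOn g (Set.Ici 0) := by
  refine antitoneOn_of_deriv_nonpos (convex_Ici 0) hc ?_ ?_ <;> rw [interior_Ici]
  · exact fun t ht => (hd t ht).differentiableAt.differentiableWithinAt
  · exact fun t ht => by rw [(hd t ht).deriv]; exact h t ht

theorem eq_of_hasDerivAt_zero {g : ℝ → ℝ} (hc : ContinuousOn g (Set.Ici 0))
    (hd : ∀ t, 0 < t → HasDerivAt g 0 t) {t : ℝ} (ht : 0 ≤ t) : g t = g 0 := by
  have h1 := antitoneOn_Ici_of_hasDerivAt hc hd fun _ _ => le_rfl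
  have h2 := antitoneOn_Ici_of_hasDerivAt hc.neg (fun t ht => (hd t ht).neg) fun _ _ => by simp
  have h3 := h1 Set.self_mem_Ici ht ht
  have h4 := h2 Set.self_mem_Ici ht ht
  simp only [Pi.neg_apply] at h4
  linarith

end Monotone

section Flow

variable {f : ℝ → ℝ → ℂ} {t : ℝ}

/-- The arc length derivatives of `κ - 2π/L`, for a constant `L`. -/
noncomputable def devDeriv (f : ℝ → ℝ → ℂ) (L : ℝ) : ℕ → ℝ → ℝ → ℝ
  | 0 => fun u t => curv f u t - 2 * Real.pi / L
  | n + 1 => arcD f (devDeriv f L n)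

/-- The integral of the square of the `n`-th arc length derivative of `κ - 2π/L`. -/
noncomputable def energy (f : ℝ → ℝ → ℂ) (L : ℝ) (n : ℕ) : ℝ → ℝ :=
  arcInt f (fun u t => devDeriv f L n u t ^ 2)

theorem energy_nonneg (f : ℝ → ℝ → ℂ) (L : ℝ) (n : ℕ) (t : ℝ) : 0 ≤ energy f L n t :=
  arcIntegral_nonneg fun _ => sq_nonneg _

namespace IsGlobalLengthPreservingFlow

theorem family_devDeriv (hf : IsGlobalLengthPreservingFlow f) (L : ℝ) (n : ℕ) :
    IsFamily (devDeriv f L n) := by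
  induction n with
  | zero =>
    have := hf.family_curv.add (IsFamily.const (-(2 * Real.pi / L)))
    simp only [← sub_eq_add_neg] at this
    exact this
  | succ n ih => exact hf.family_arcD ih

theorem family_sq_devDeriv (hf : IsGlobalLengthPreservingFlow f) (L : ℝ) (n : ℕ) :
    IsFamily (fun u t => devDeriv f L n u t ^ 2) := by
  simpa only [sq] using (hf.family_devDeriv L n).mul (hf.family_devDeriv L n)

theorem continuousOn_energy (hf : IsGlobalLengthPreservingFlow f) (L : ℝ) (n : ℕ) :
    ContinuousOn (energy f L n) (Set.Ici 0) :=
  hf.continuousOn_arcInt (hf.family_sq_devDeriv L n)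

/-- In the evolution of `κ ds` the term `κ²F` cancels against the variation of `ds`, leaving the
exact term `κₛₛ ds`. The rotation number thus matters only at the initial time. -/
theorem arcInt_curv (hf : IsGlobalLengthPreservingFlow f)
    (hrot : HasRotationNumber (curveAt f 0) 1) (ht : 0 ≤ t) :
    arcInt f (curv f) t = 2 * Real.pi := by
  have h0 : arcInt f (curv f) 0 = 2 * Real.pi := by
    refine ((hf.loop le_rfl).arcIntegral_curvature hrot).trans ?_
    simp
  rw [← h0]
  refine eq_of_hasDerivAt_zero (hf.continuousOn_arcInt hf.family_curv) (fun t ht => ?_) ht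
  refine (hf.hasDerivAt_arcInt ht hf.family_curv).congr_deriv ?_
  have h1 : arcInt f (arcD f (arcD f (curv f))) t = 0 :=
    (hf.loop ht.le).arcIntegral_arcDeriv ((hf.family_arcD hf.family_curv).slice ht.le)
      ((hf.family_arcD hf.family_curv).periodic t ht.le)
  rw [← h1]
  refine congrArg (arcIntegral (curveAt f t)) (funext fun u => ?_)
  simp only [hf.timeDeriv_curv ht]; ring

theorem continuous_curv (hf : IsGlobalLengthPreservingFlow f) (ht : 0 ≤ t) :
    Continuous (fun u => curv f u t) := (hf.family_curv.slice ht).continuous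

/-- `L' = -∫ κF ds = -∫ κ² ds + (1/2π) ∫ κ² ds ∫ κ ds`, which vanishes because the total curvature
is `2π`. -/
theorem length_eq (hf : IsGlobalLengthPreservingFlow f)
    (hrot : HasRotationNumber (curveAt f 0) 1) (ht : 0 ≤ t) :
    length (curveAt f t) = length (curveAt f 0) := by
  have hfam : IsFamily (fun _ _ => (1 : ℝ)) := IsFamily.const 1
  refine eq_of_hasDerivAt_zero (g := arcInt f fun _ _ => (1 : ℝ))
    (hf.continuousOn_arcInt hfam) (fun t ht => ?_) ht
  refine (hf.hasDerivAt_arcInt ht hfam).congr_deriv ?_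
  set c := 1 / (2 * Real.pi) * arcInt f (fun u t => curv f u t ^ 2) t with hc
  have hcurv := hf.continuous_curv ht.le
  have h1 : arcInt f (fun u t => timeDeriv (fun _ _ => (1 : ℝ)) u t
      - curv f u t * normalSpeed f u t * 1) t
      = arcIntegral (curveAt f t) (fun u => c * curv f u t - curv f u t ^ 2) := by
    refine congrArg (arcIntegral (curveAt f t)) (funext fun u => ?_)
    simp only [timeDeriv, deriv_const, normalSpeed, ← hc]; ring
  rw [h1, (hf.loop ht.le).arcIntegral_sub (by fun_prop) (by fun_prop), arcIntegral_const_mul]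
  have h2 := hf.arcInt_curv hrot ht.le
  have hpi := Real.pi_pos
  simp only [arcInt] at h2 hc
  rw [h2, hc]; field_simp; ring

theorem arcInt_devDeriv_zero (hf : IsGlobalLengthPreservingFlow f)
    (hrot : HasRotationNumber (curveAt f 0) 1) (ht : 0 ≤ t) :
    arcInt f (devDeriv f (length (curveAt f 0)) 0) t = 0 := by
  have hL := (hf.loop le_rfl).length_pos
  have h2 := hf.arcInt_curv hrot ht
  simp only [arcInt, devDeriv] at h2 ⊢
  rw [(hf.loop ht).arcIntegral_sub (hf.continuous_curv ht) continuous_const, h2, arcIntegral_const,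
    hf.length_eq hrot ht]
  field_simp; ring

/-- The constant in the normal speed equals `2π/L + (1/2π) ∫ (κ - 2π/L)² ds`. -/
theorem normalSpeed_eq (hf : IsGlobalLengthPreservingFlow f)
    (hrot : HasRotationNumber (curveAt f 0) 1) (ht : 0 ≤ t) (u : ℝ) :
    normalSpeed f u t = devDeriv f (length (curveAt f 0)) 0 u t
      - energy f (length (curveAt f 0)) 0 t / (2 * Real.pi) := by
  have hL := (hf.loop le_rfl).length_pos
  set L := length (curveAt f 0) with hLdef
  have hpi := Real.pi_pos
  have h2 := hf.arcInt_curv hrot ht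
  have hcurv := hf.continuous_curv ht
  have hLt : length (curveAt f t) = L := hf.length_eq hrot ht
  have h3 : energy f L 0 t = arcInt f (fun u t => curv f u t ^ 2) t - (2 * Real.pi) ^ 2 / L := by
    have h4 : energy f L 0 t = arcIntegral (curveAt f t) (fun u => curv f u t ^ 2
        - (2 * (2 * Real.pi / L)) * curv f u t + (2 * Real.pi / L) ^ 2) := by
      refine congrArg (arcIntegral (curveAt f t)) (funext fun u => ?_)
      simp only [devDeriv]; ring
    rw [h4, (hf.loop ht).arcIntegral_add (by fun_prop) (by fun_prop),
      (hf.loop ht).arcIntegral_sub (by fun_prop) (by fun_prop), arcIntegral_const_mul,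
      arcIntegral_const, hLt]
    simp only [arcInt] at h2 ⊢
    rw [h2]; field_simp; ring
  rw [normalSpeed, h3, devDeriv]
  field_simp; ring

/-- Integrating `⟨f, T⟩ κₛ` by parts, with `κₛ = Fₛ` and `∂ₛ⟨f, T⟩ = 1 + κ⟨f, ν⟩`, yields `A' = -∫ F
ds`. Since `F = w - E_0/2π` and `w` has mean zero, this is `(L/2π) E_0`. -/
theorem hasDerivAt_signedArea (hf : IsGlobalLengthPreservingFlow f)
    (hrot : HasRotationNumber (curveAt f 0) 1) (ht : 0 < t) :
    HasDerivAt (fun τ => signedArea (curveAt f τ))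
      (length (curveAt f 0) / (2 * Real.pi) * energy f (length (curveAt f 0)) 0 t) t := by
  set L := length (curveAt f 0) with hLdef
  have hloop := hf.loop ht.le
  have hN : IsFamily (fun u t => Complex.I * tang f u t) :=
    hf.family_tang.clm (ContinuousLinearMap.mul ℝ ℂ Complex.I)
  have hG := hf.family.inner hN
  have hT := hf.family.inner hf.family_tang
  have h1 := (hf.hasDerivAt_arcInt ht hG).const_mul (-(1 / 2 : ℝ))
  refine h1.congr_deriv ?_
  have hFs : ContDiff ℝ ∞ (fun u => normalSpeed f u t) :=
    (hf.family_curv.slice ht.le).sub contDiff_const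
  have hFp : Function.Periodic (fun u => normalSpeed f u t) 1 := fun u =>
    congrArg (fun x => x - _) (hf.family_curv.periodic t ht.le u)
  set p : ℝ → ℝ := fun u => inner ℝ (f u t) (Complex.I * tang f u t) with hp
  have hpc : Continuous p := (hG.slice ht.le).continuous
  have hTT : ∀ u, inner ℝ (tang f u t) (tang f u t) = (1 : ℝ) := fun u => by
    rw [real_inner_self_eq_norm_sq, hf.norm_tang ht.le]; norm_num
  have hNN : ∀ u, inner ℝ (Complex.I * tang f u t) (Complex.I * tang f u t) = (1 : ℝ) := fun u => by
    rw [real_inner_self_eq_norm_sq, norm_mul, Complex.norm_I, hf.norm_tang ht.le]; norm_num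
  have h2 : ∀ u, timeDeriv (fun u t => (inner ℝ (f u t) (Complex.I * tang f u t) : ℝ)) u t
      = normalSpeed f u t - inner ℝ (f u t) (tang f u t) * arcD f (curv f) u t := by
    intro u
    have h3 := (hf.family.hasDerivAt_time ht u).inner ℝ
      ((hf.family_tang.hasDerivAt_time ht u).const_mul Complex.I)
    refine h3.deriv.trans ?_
    rw [hf.timeDeriv_eq ht, hf.timeDeriv_tang ht, ← Complex.real_smul, ← Complex.real_smul,
      inner_smul_left, hNN, mul_smul_comm, ← mul_assoc, Complex.I_mul_I, inner_smul_right]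
    simp; ring
  have h5 : ∀ u, arcDeriv (curveAt f t) (fun v => (inner ℝ (f v t) (tang f v t) : ℝ)) u
      = 1 + curv f u t * p u := by
    intro u
    have h3 := (hf.hasDerivAt_space ht.le hf.family u).inner ℝ
      (hf.hasDerivAt_space ht.le hf.family_tang u)
    have hv : ‖deriv (curveAt f t) u‖ ≠ 0 := (hf.speed_pos ht.le u).ne'
    rw [arcDeriv, h3.deriv, hf.arcD_tang ht.le, ← Complex.real_smul]
    change ‖deriv (curveAt f t) u‖⁻¹ • (inner ℝ (f u t) (‖deriv (curveAt f t) u‖ • curv f u t •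
      (Complex.I * tang f u t)) + inner ℝ (‖deriv (curveAt f t) u‖ • tang f u t) (tang f u t)) = _
    rw [inner_smul_right, inner_smul_right, inner_smul_left, hTT, smul_eq_mul]
    simp only [conj_trivial]
    field_simp
    ring
  have h6 := hloop.arcIntegral_by_parts (hT.slice ht.le) hFs (hT.periodic t ht.le) hFp
  have h7 : arcDeriv (curveAt f t) (fun u => normalSpeed f u t) = fun u => arcD f (curv f) u t := by
    funext u
    rw [arcDeriv, (hf.hasDerivAt_normalSpeed ht.le u).deriv, smul_eq_mul]
    exact inv_mul_cancel_left₀ (hf.speed_pos ht.le u).ne' _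
  rw [h7] at h6
  simp only [h5] at h6
  have hFc := hFs.continuous
  have hcurv := hf.continuous_curv ht.le
  have hTc := (hT.slice ht.le).continuous
  have hκsc := ((hf.family_arcD hf.family_curv).slice ht.le).continuous
  have h8 : arcInt f (fun u t => timeDeriv
        (fun u t => (inner ℝ (f u t) (Complex.I * tang f u t) : ℝ)) u t
      - curv f u t * normalSpeed f u t * inner ℝ (f u t) (Complex.I * tang f u t)) t
      = arcIntegral (curveAt f t) (fun u => 2 * normalSpeed f u t
        - inner ℝ (f u t) (tang f u t) * arcD f (curv f) u t
        - (1 + curv f u t * p u) * normalSpeed f u t) := by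
    refine congrArg (arcIntegral (curveAt f t)) (funext fun u => ?_)
    simp only [h2]; ring
  rw [h8, hloop.arcIntegral_sub (by fun_prop) (by fun_prop),
    hloop.arcIntegral_sub (by fun_prop) (by fun_prop), h6, arcIntegral_const_mul]
  have h9 : arcIntegral (curveAt f t) (fun u => normalSpeed f u t)
      = - (L / (2 * Real.pi) * energy f L 0 t) := by
    have h10 := hf.arcInt_devDeriv_zero hrot ht.le
    simp only [hf.normalSpeed_eq hrot ht.le]
    rw [hloop.arcIntegral_sub ((hf.family_devDeriv L 0).slice ht.le).continuous continuous_const,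
      arcIntegral_const, hf.length_eq hrot ht.le]
    simp only [arcInt] at h10
    rw [h10]; ring
  rw [h9]; ring

theorem continuousOn_signedArea (hf : IsGlobalLengthPreservingFlow f) :
    ContinuousOn (fun τ => signedArea (curveAt f τ)) (Set.Ici 0) :=
  (hf.continuousOn_arcInt (hf.family.inner
    (hf.family_tang.clm (ContinuousLinearMap.mul ℝ ℂ Complex.I)))).const_mul _

end IsGlobalLengthPreservingFlow

end Flow

end PlaneCurve

/-! ### Exponential decay from differential inequalities -/

namespace PlaneCurve

section Decay

open MeasureTheory

/-- Primitives of functions that are continuous for nonnegative times. -/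
theorem exists_primitive_Ici {g : ℝ → ℝ} (hg : ContinuousOn g (Set.Ici 0)) :
    ∃ G : ℝ → ℝ, Continuous G ∧ (∀ t, 0 < t → HasDerivAt G (g t) t) ∧
      ∀ a b, 0 ≤ a → 0 ≤ b → ∫ s in a..b, g s = G b - G a := by
  have hc : Continuous fun t => g (max t 0) :=
    hg.comp_continuous (by fun_prop) fun t => by simp
  have hd := fun t => (hc.integral_hasStrictDerivAt 0 t).hasDerivAt
  refine ⟨fun t => ∫ s in (0 : ℝ)..t, g (max s 0),
    continuous_iff_continuousAt.2 fun t => (hd t).continuousAt, fun t ht => ?_,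
    fun a b ha hb => ?_⟩
  · simpa [max_eq_left ht.le] using hd t
  · rw [intervalIntegral.integral_interval_sub_left (hc.intervalIntegrable _ _)
      (hc.intervalIntegrable _ _)]
    refine intervalIntegral.integral_congr fun s hs => ?_
    have : 0 ≤ s := (le_min ha hb).trans hs.1
    simp only [max_eq_left this]

theorem intervalIntegrable_Ici {g : ℝ → ℝ} (hg : ContinuousOn g (Set.Ici 0)) {a b : ℝ}
    (ha : 0 ≤ a) (hb : 0 ≤ b) : IntervalIntegrable g volume a b :=
  (hg.mono fun _ hs => (le_min ha hb).trans hs.1).intervalIntegrable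

/-- A bounded below function that decreases at a rate comparable to its absolute value
decreases exponentially. -/
theorem integral_le_exp_of_deficit {D g : ℝ → ℝ} {a b B : ℝ} (ha : 0 < a) (hb : 0 < b)
    (hDc : ContinuousOn D (Set.Ici 0)) (hgc : ContinuousOn g (Set.Ici 0))
    (hD : ∀ t, 0 < t → HasDerivAt D (-a * g t) t) (hg : ∀ t, 0 ≤ g t)
    (hDg : ∀ t, 0 ≤ t → |D t| ≤ b * g t) (hB : ∀ t, 0 ≤ t → -B ≤ D t) :
    ∃ K : ℝ, ∀ t, 0 ≤ t → ∫ s in t..t + 1, g s ≤ K * Real.exp (-(a / b) * t) := by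
  have hanti := antitoneOn_Ici_of_hasDerivAt hDc hD
    fun t _ => by have := mul_nonneg ha.le (hg t); linarith
  -- Once negative, `D` would stay below that value, which forces `g ≥ |D t| / b` from then on; `D`
  -- would fall at least linearly and violate its lower bound.
  have hpos : ∀ t, 0 ≤ t → 0 ≤ D t := by
    intro t ht
    by_contra hneg
    push Not at hneg
    have h1 : AntitoneOn (fun s => D (t + s) - (a / b * D t) * s) (Set.Ici 0) := by
      refine antitoneOn_Ici_of_hasDerivAt
        (g' := fun s => -a * g (t + s) - (a / b * D t)) ?_ (fun s hs => ?_) fun s hs => ?_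
      · exact (hDc.comp (by fun_prop) fun s hs => add_nonneg ht hs).sub (by fun_prop)
      · have := ((hD (t + s) (by linarith)).comp_const_add t s).sub
          ((hasDerivAt_id' s).const_mul (a / b * D t))
        exact this.congr_deriv (by ring)
      · have h2 := hDg (t + s) (by linarith)
        have h3 : D (t + s) ≤ D t := hanti ht (add_nonneg ht hs.le) (by linarith)
        have h4 : -D t ≤ b * g (t + s) := by
          have := neg_abs_le (D (t + s)); linarith
        have h5 : a / b * (-D t) ≤ a / b * (b * g (t + s)) := by gcongr
        have h6 : a / b * (b * g (t + s)) = a * g (t + s) := by field_simp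
        rw [h6] at h5
        linarith
    have hc : 0 < a / b * (-D t) := by
      have : 0 < -D t := by linarith
      positivity
    obtain ⟨n, hn⟩ := exists_nat_gt (B / (a / b * (-D t)))
    have h7 := h1 Set.self_mem_Ici (Set.mem_Ici.2 (Nat.cast_nonneg n)) (Nat.cast_nonneg n)
    have h8 := hB (t + n) (by positivity)
    rw [div_lt_iff₀ hc] at hn
    simp only [add_zero, mul_zero, sub_zero] at h7
    nlinarith
  -- Grönwall for `D' = -a g ≤ -(a/b) D`.
  have hexp : AntitoneOn (fun t => D t * Real.exp (a / b * t)) (Set.Ici 0) := by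
    refine antitoneOn_Ici_of_hasDerivAt
      (g' := fun t => (-a * g t + a / b * D t) * Real.exp (a / b * t)) ?_ (fun t ht => ?_)
      fun t ht => ?_
    · exact hDc.mul (by fun_prop)
    · refine ((hD t ht).mul ((hasDerivAt_id' t).const_mul (a / b)).exp).congr_deriv ?_
      ring
    · refine mul_nonpos_of_nonpos_of_nonneg ?_ (Real.exp_pos _).le
      have h2 := (le_abs_self _).trans (hDg t ht.le)
      have h5 : a / b * D t ≤ a / b * (b * g t) := by gcongr
      have h6 : a / b * (b * g t) = a * g t := by field_simp
      linarith
  obtain ⟨G, hGc, hGd, hGi⟩ := exists_primitive_Ici hgc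
  have hconst : ∀ t, 0 ≤ t → D t + a * G t = D 0 + a * G 0 := fun t ht =>
    eq_of_hasDerivAt_zero (g := fun t => D t + a * G t) (hDc.add (by fun_prop))
      (fun t ht => ((hD t ht).add ((hGd t ht).const_mul a)).congr_deriv (by ring)) ht
  -- `a ∫ g` over `[t, t+1]` is `D t - D (t+1)`, at most `D t` by the nonnegativity of `D`.
  refine ⟨D 0 / a, fun t ht => ?_⟩
  rw [hGi t (t + 1) ht (by linarith)]
  have h1 := hconst t ht
  have h2 := hconst (t + 1) (by linarith)
  have h3 := hpos (t + 1) (by linarith)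
  have h4 : D t * Real.exp (a / b * t) ≤ D 0 := by
    simpa using hexp Set.self_mem_Ici ht ht
  have h5 : D t ≤ D 0 * Real.exp (-(a / b) * t) := by
    rw [neg_mul, Real.exp_neg, ← div_eq_mul_inv, le_div_iff₀ (Real.exp_pos _)]
    exact h4
  have h6 : a * (G (t + 1) - G t) ≤ D 0 * Real.exp (-(a / b) * t) := by linarith
  rw [div_mul_eq_mul_div, le_div_iff₀ ha]
  linarith

/-- A nonnegative solution of `g' ≤ -h + C (g + g³)` whose integrals over unit intervals decay
exponentially decays exponentially, and so do the integrals of `h`. -/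
theorem exp_decay_of_integral {g g' h : ℝ → ℝ} {C K lam : ℝ} (hC : 0 ≤ C)
    (hlam : 0 < lam) (hgc : ContinuousOn g (Set.Ici 0)) (hhc : ContinuousOn h (Set.Ici 0))
    (hg : ∀ t, 0 ≤ g t) (hh : ∀ t, 0 ≤ h t) (hd : ∀ t, 0 < t → HasDerivAt g (g' t) t)
    (hle : ∀ t, 0 < t → g' t ≤ -h t + C * (g t + g t ^ 3))
    (hint : ∀ t, 0 ≤ t → ∫ s in t..t + 1, g s ≤ K * Real.exp (-lam * t)) :
    (∃ K', ∀ t, 0 ≤ t → g t ≤ K' * Real.exp (-lam * t)) ∧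
      ∃ K', ∀ t, 0 ≤ t → ∫ s in t..t + 1, h s ≤ K' * Real.exp (-lam * t) := by
  -- `ψ = g² / (1 + g²)` satisfies the linear inequality `ψ' ≤ 2 C ψ`
  have hψ : AntitoneOn (fun t => g t ^ 2 / (1 + g t ^ 2) * Real.exp (-(2 * C) * t))
      (Set.Ici 0) := by
    refine antitoneOn_Ici_of_hasDerivAt (g' := fun t =>
      (2 * g t / (1 + g t ^ 2) ^ 2 * (g' t - C * (g t + g t ^ 3))) * Real.exp (-(2 * C) * t))
      ?_ (fun t ht => ?_) fun t ht => ?_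
    · exact ((hgc.pow 2).div (continuousOn_const.add (hgc.pow 2))
        fun t _ => show 1 + g t ^ 2 ≠ 0 by positivity).mul (by fun_prop)
    · have h1 : (1 + g t ^ 2) ≠ 0 := by positivity
      refine ((((hd t ht).pow 2).div (((hd t ht).pow 2).const_add 1) h1).mul
        ((hasDerivAt_id' t).const_mul (-(2 * C))).exp).congr_deriv ?_
      simp
      field_simp
      ring
    · refine mul_nonpos_of_nonpos_of_nonneg (mul_nonpos_of_nonneg_of_nonpos ?_ ?_)
        (Real.exp_pos _).le
      · have := hg t; positivity
      · have := hle t ht; have := hh t; linarith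
  -- Looking back over `[t-1, t]`: there `e^(-2C) ψ(t) ≤ ψ(s) ≤ g(s)²`, so `e^(-C) √ψ(t)` is at most
  -- the integral of `g`, whose decay is known.
  have hstep : ∀ t, 1 ≤ t → Real.sqrt (g t ^ 2 / (1 + g t ^ 2))
      ≤ Real.exp C * (K * Real.exp lam * Real.exp (-lam * t)) := by
    intro t ht
    have h1 : ∀ s ∈ Set.Icc (t - 1) (t - 1 + 1),
        Real.exp (-C) * Real.sqrt (g t ^ 2 / (1 + g t ^ 2)) ≤ g s := by
      intro s hs
      have hs0 : 0 ≤ s := by linarith [hs.1]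
      have h2 := hψ hs0 (show (0 : ℝ) ≤ t by linarith) (show s ≤ t by linarith [hs.2])
      simp only at h2
      have h3 : g t ^ 2 / (1 + g t ^ 2) * Real.exp (-(2 * C)) ≤ g s ^ 2 := by
        have h4 : Real.exp (-(2 * C)) * Real.exp (-(2 * C) * s) ≤ Real.exp (-(2 * C) * t) := by
          rw [← Real.exp_add]
          apply Real.exp_le_exp.2
          nlinarith [hs.1]
        have h5 : g s ^ 2 / (1 + g s ^ 2) ≤ g s ^ 2 :=
          div_le_self (sq_nonneg _) (by nlinarith [sq_nonneg (g s)])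
        have h6 : (g t ^ 2 / (1 + g t ^ 2) * Real.exp (-(2 * C))) * Real.exp (-(2 * C) * s)
            ≤ g s ^ 2 * Real.exp (-(2 * C) * s) := by
          calc _ = g t ^ 2 / (1 + g t ^ 2) * (Real.exp (-(2 * C)) * Real.exp (-(2 * C) * s)) := by
                ring
            _ ≤ g t ^ 2 / (1 + g t ^ 2) * Real.exp (-(2 * C) * t) := by gcongr
            _ ≤ g s ^ 2 / (1 + g s ^ 2) * Real.exp (-(2 * C) * s) := h2
            _ ≤ _ := by gcongr
        exact le_of_mul_le_mul_right h6 (Real.exp_pos _)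
      refine (abs_le_of_sq_le_sq' ?_ (hg s)).2
      rw [mul_pow, Real.sq_sqrt (by positivity), ← Real.exp_nat_mul]
      have : ((2 : ℕ) : ℝ) * -C = -(2 * C) := by push_cast; ring
      rw [this]; linarith
    have h7 := intervalIntegral.integral_mono_on (μ := volume) (show t - 1 ≤ t - 1 + 1 by linarith)
      (by simp) (intervalIntegrable_Ici hgc (by linarith) (by linarith)) h1
    rw [intervalIntegral.integral_const] at h7
    have h8 := h7.trans (hint (t - 1) (by linarith))
    simp only [add_sub_cancel_left, one_smul] at h8
    rw [show -lam * (t - 1) = lam + -lam * t by ring, Real.exp_add] at h8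
    rw [Real.exp_neg, inv_mul_le_iff₀ (Real.exp_pos _)] at h8
    linarith
  set M := Real.exp C * (K * Real.exp lam) with hM
  -- After `T` one has `ψ ≤ 1/4`, and there `g ≤ 2√ψ`. Before `T` compactness suffices.
  obtain ⟨T, hT1, hT⟩ : ∃ T : ℝ, 1 ≤ T ∧ ∀ t, T ≤ t → M * Real.exp (-lam * t) ≤ 1 / 2 := by
    have : Filter.Tendsto (fun t : ℝ => M * Real.exp (-lam * t)) Filter.atTop (nhds 0) := by
      have h1 : Filter.Tendsto (fun t : ℝ => -lam * t) Filter.atTop Filter.atBot :=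
        Filter.tendsto_id.const_mul_atTop_of_neg (by linarith)
      simpa using (Real.tendsto_exp_atBot.comp h1).const_mul M
    obtain ⟨T, hT⟩ := Filter.eventually_atTop.1
      (this.eventually (ge_mem_nhds (show (0 : ℝ) < 1 / 2 by norm_num)))
    exact ⟨max T 1, le_max_right _ _, fun t ht => hT t ((le_max_left _ _).trans ht)⟩
  have hlarge : ∀ t, T ≤ t → g t ≤ 2 * M * Real.exp (-lam * t) := by
    intro t ht
    have h1 := hstep t (hT1.trans ht)
    have h2 := hT t ht
    set x := M * Real.exp (-lam * t) with hx
    have h3 : Real.sqrt (g t ^ 2 / (1 + g t ^ 2)) ≤ x := by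
      rw [hx, hM]; linarith
    have hx0 : 0 ≤ x := (Real.sqrt_nonneg _).trans h3
    have h4 : g t ^ 2 / (1 + g t ^ 2) ≤ x ^ 2 := (Real.sqrt_le_left hx0).1 h3
    rw [div_le_iff₀ (by positivity)] at h4
    have h5 : x ^ 2 ≤ 1 / 4 := by nlinarith
    have h6 : g t ^ 2 ≤ (2 * x) ^ 2 := by nlinarith [sq_nonneg (g t)]
    have h7 := (abs_le_of_sq_le_sq' h6 (by linarith)).2
    linarith
  obtain ⟨B, hB⟩ := (isCompact_Icc (a := (0 : ℝ)) (b := T)).exists_bound_of_continuousOn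
    (hgc.mono fun t ht => ht.1)
  have hB0 : 0 ≤ B := (norm_nonneg _).trans (hB 0 ⟨le_rfl, by linarith⟩)
  have hfirst : ∃ K', ∀ t, 0 ≤ t → g t ≤ K' * Real.exp (-lam * t) := by
    refine ⟨max (2 * M) (B * Real.exp (lam * T)), fun t ht => ?_⟩
    rcases le_total T t with hTt | hTt
    · exact (hlarge t hTt).trans (by gcongr; exact le_max_left _ _)
    · calc g t ≤ B := (le_abs_self _).trans (hB t ⟨ht, hTt⟩)
        _ = B * Real.exp (lam * T) * Real.exp (-lam * T) := by
          rw [mul_assoc, ← Real.exp_add]; simp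
        _ ≤ B * Real.exp (lam * T) * Real.exp (-lam * t) := by
          have : Real.exp (-lam * T) ≤ Real.exp (-lam * t) := Real.exp_le_exp.2 (by nlinarith)
          gcongr
        _ ≤ _ := by gcongr; exact le_max_right _ _
  refine ⟨hfirst, ?_⟩
  obtain ⟨K', hK'⟩ := hfirst
  have hK'0 : 0 ≤ K' := by have := (hg 0).trans (hK' 0 le_rfl); simpa using this
  obtain ⟨H, hHc, hHd, hHi⟩ := exists_primitive_Ici hhc
  -- along the flow `g ≤ K'`, so that `g' ≤ -h + C (1 + K'²) K' exp (-lam t)`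
  set A := C * (K' + K' ^ 3) with hA
  have hA0 : 0 ≤ A := by positivity
  have hanti : AntitoneOn (fun t => g t + H t + A / lam * Real.exp (-lam * t)) (Set.Ici 0) := by
    refine antitoneOn_Ici_of_hasDerivAt
      (g' := fun t => g' t + h t - A * Real.exp (-lam * t)) ?_ (fun t ht => ?_) fun t ht => ?_
    · exact (hgc.add hHc.continuousOn).add (by fun_prop)
    · refine (((hd t ht).add (hHd t ht)).add
        (((hasDerivAt_id' t).const_mul (-lam)).exp.const_mul (A / lam))).congr_deriv ?_
      field_simp
      ring
    · have h1 := hle t ht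
      set e := Real.exp (-lam * t) with he
      have he0 : 0 < e := Real.exp_pos _
      have he1 : e ≤ 1 := Real.exp_le_one_iff.2 (by nlinarith)
      have h2 : g t ≤ K' * e := hK' t ht.le
      have h3 : g t ^ 3 ≤ (K' * e) ^ 3 := by have := hg t; gcongr
      have h4 : (K' * e) ^ 3 ≤ K' ^ 3 * e := by
        rw [mul_pow]
        have : e ^ 3 ≤ e := by
          have := pow_le_of_le_one he0.le he1 (n := 3) (by norm_num); exact this
        gcongr
      have h5 : C * (g t + g t ^ 3) ≤ C * (K' * e + K' ^ 3 * e) := by gcongr; linarith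
      have h6 : C * (K' * e + K' ^ 3 * e) = A * e := by rw [hA]; ring
      linarith
  -- The integral of `h` is bounded by the value at `t` of `g + (A/lam) exp(-lam t)`, since the
  -- monotone quantity has nonnegative such terms at `t + 1`.
  refine ⟨K' + A / lam, fun t ht => ?_⟩
  rw [hHi t (t + 1) ht (by linarith)]
  have h1 := hanti ht (show (0 : ℝ) ≤ t + 1 by linarith) (by linarith)
  simp only at h1
  have h2 := hg (t + 1)
  have h3 : 0 ≤ A / lam * Real.exp (-lam * (t + 1)) := by positivity
  have h4 := hK' t ht
  linarith

end Decay

end PlaneCurve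

/-! ### Differential inequalities for the energies -/

namespace PlaneCurve

section Flow

variable {f : ℝ → ℝ → ℂ} {t : ℝ}

/-- Sums of products of at most three arc length derivatives of the curvature deviation with
bounded time-dependent coefficients, where one factor has order at most `n` and the others have
order less than `n`. -/
inductive IsLower (f : ℝ → ℝ → ℂ) (L : ℝ) (n : ℕ) : (ℝ → ℝ → ℝ) → Prop
  | linear {a : ℝ → ℝ} {A : ℝ} (ha : ∀ t, 0 < t → |a t| ≤ A) {i : ℕ} (hi : i ≤ n) :
      IsLower f L n (fun u t => a t * devDeriv f L i u t)
  | quadratic {a : ℝ → ℝ} {A : ℝ} (ha : ∀ t, 0 < t → |a t| ≤ A) {i j : ℕ} (hi : i ≤ n)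
      (hj : j < n) : IsLower f L n (fun u t => a t * devDeriv f L j u t * devDeriv f L i u t)
  | cubic {a : ℝ → ℝ} {A : ℝ} (ha : ∀ t, 0 < t → |a t| ≤ A) {i j k : ℕ} (hi : i ≤ n)
      (hj : j < n) (hk : k < n) : IsLower f L n
        (fun u t => a t * (devDeriv f L j u t * devDeriv f L k u t) * devDeriv f L i u t)
  | add {G H : ℝ → ℝ → ℝ} (hG : IsLower f L n G) (hH : IsLower f L n H) :
      IsLower f L n (fun u t => G u t + H u t)

namespace IsGlobalLengthPreservingFlow

theorem contDiff_devDeriv (hf : IsGlobalLengthPreservingFlow f) (L : ℝ) (n : ℕ) (ht : 0 ≤ t) :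
    ContDiff ℝ ∞ (fun u => devDeriv f L n u t) := (hf.family_devDeriv L n).slice ht

theorem continuous_devDeriv (hf : IsGlobalLengthPreservingFlow f) (L : ℝ) (n : ℕ) (ht : 0 ≤ t) :
    Continuous (fun u => devDeriv f L n u t) := (hf.contDiff_devDeriv L n ht).continuous

theorem contDiff_of_isLower (hf : IsGlobalLengthPreservingFlow f) {L : ℝ} {n : ℕ}
    {G : ℝ → ℝ → ℝ} (hG : IsLower f L n G) (ht : 0 ≤ t) : ContDiff ℝ ∞ (fun u => G u t) := by
  induction hG with
  | linear ha hi => exact contDiff_const.mul (hf.contDiff_devDeriv L _ ht)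
  | quadratic ha hi hj =>
    exact (contDiff_const.mul (hf.contDiff_devDeriv L _ ht)).mul (hf.contDiff_devDeriv L _ ht)
  | cubic ha hi hj hk =>
    exact (contDiff_const.mul ((hf.contDiff_devDeriv L _ ht).mul (hf.contDiff_devDeriv L _ ht))).mul
      (hf.contDiff_devDeriv L _ ht)
  | add hG hH ihG ihH => exact ihG.add ihH

theorem arcD_eq_of_hasDerivAt (hf : IsGlobalLengthPreservingFlow f) (ht : 0 ≤ t) {G : ℝ → ℝ → ℝ}
    {u x : ℝ} (h : HasDerivAt (fun v => G v t) (speed f u t * x) u) : arcD f G u t = x := by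
  rw [arcD, arcDeriv, h.deriv]
  exact inv_mul_cancel_left₀ (hf.speed_pos ht u).ne' _

theorem hasDerivAt_devDeriv (hf : IsGlobalLengthPreservingFlow f) (L : ℝ) (n : ℕ) (ht : 0 ≤ t)
    (u : ℝ) : HasDerivAt (fun v => devDeriv f L n v t)
      (speed f u t * devDeriv f L (n + 1) u t) u :=
  hf.hasDerivAt_space ht (hf.family_devDeriv L n) u

/-- The coefficients depend on time only, and the product rule raises one order by one at a time, so
the class is carried from `n` to `n + 1`. -/
theorem hasDerivAt_of_isLower (hf : IsGlobalLengthPreservingFlow f) {L : ℝ} {n : ℕ}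
    {G : ℝ → ℝ → ℝ} (hG : IsLower f L n G) : ∃ G', IsLower f L (n + 1) G' ∧
      ∀ t, 0 ≤ t → ∀ u, HasDerivAt (fun v => G v t) (speed f u t * G' u t) u := by
  induction hG with
  | linear ha hi =>
    refine ⟨_, .linear ha (Nat.succ_le_succ hi), fun t ht u => ?_⟩
    refine ((hf.hasDerivAt_devDeriv L _ ht u).const_mul _).congr_deriv ?_
    ring
  | quadratic ha hi hj =>
    refine ⟨_, .add (.quadratic ha (Nat.succ_le_succ hi) (hj.trans n.lt_succ_self))
      (.quadratic ha (hi.trans n.le_succ) (Nat.succ_lt_succ hj)), fun t ht u => ?_⟩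
    refine (((hf.hasDerivAt_devDeriv L _ ht u).const_mul _).mul
      (hf.hasDerivAt_devDeriv L _ ht u)).congr_deriv ?_
    ring
  | cubic ha hi hj hk =>
    refine ⟨_, .add (.cubic ha (Nat.succ_le_succ hi) (hj.trans n.lt_succ_self)
      (hk.trans n.lt_succ_self)) (.add (.cubic ha (hi.trans n.le_succ) (Nat.succ_lt_succ hj)
      (hk.trans n.lt_succ_self)) (.cubic ha (hi.trans n.le_succ) (hj.trans n.lt_succ_self)
      (Nat.succ_lt_succ hk))), fun t ht u => ?_⟩
    refine ((((hf.hasDerivAt_devDeriv L _ ht u).mul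
      (hf.hasDerivAt_devDeriv L _ ht u)).const_mul _).mul
      (hf.hasDerivAt_devDeriv L _ ht u)).congr_deriv ?_
    simp only [Pi.mul_apply, Nat.succ_eq_add_one]
    ring
  | add hG hH ihG ihH =>
    obtain ⟨G', hG', hGd⟩ := ihG
    obtain ⟨H', hH', hHd⟩ := ihH
    exact ⟨_, .add hG' hH', fun t ht u =>
      ((hGd t ht u).add (hHd t ht u)).congr_deriv (by ring)⟩

/-! ### Interpolation -/

theorem arcInt_devDeriv (hf : IsGlobalLengthPreservingFlow f)
    (hrot : HasRotationNumber (curveAt f 0) 1) (n : ℕ) (ht : 0 ≤ t) :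
    arcInt f (devDeriv f (length (curveAt f 0)) n) t = 0 := by
  cases n with
  | zero => exact hf.arcInt_devDeriv_zero hrot ht
  | succ n =>
    exact (hf.loop ht).arcIntegral_arcDeriv (hf.contDiff_devDeriv _ n ht)
      ((hf.family_devDeriv _ n).periodic t ht)

/-- Every derivative of `w` has mean zero, so the Sobolev inequality has no mean term, and
Cauchy–Schwarz turns the total variation into `E_{n+1}`. -/
theorem sq_devDeriv_le (hf : IsGlobalLengthPreservingFlow f)
    (hrot : HasRotationNumber (curveAt f 0) 1) (n : ℕ) (ht : 0 ≤ t) {u : ℝ}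
    (hu : u ∈ Set.Icc (0 : ℝ) 1) : devDeriv f (length (curveAt f 0)) n u t ^ 2
      ≤ length (curveAt f 0) * energy f (length (curveAt f 0)) (n + 1) t := by
  set L := length (curveAt f 0)
  have h1 := (hf.loop ht).abs_le_of_arcDeriv (hf.contDiff_devDeriv L n ht) hu
  have h2 : arcIntegral (curveAt f t) (fun u => devDeriv f L n u t) = 0 :=
    hf.arcInt_devDeriv hrot n ht
  rw [h2, abs_zero, zero_div, zero_add] at h1
  have h3 := (hf.loop ht).sq_arcIntegral_abs_le (hf.continuous_devDeriv L (n + 1) ht)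
  rw [hf.length_eq hrot ht] at h3
  rw [← sq_abs]
  exact (pow_le_pow_left₀ (abs_nonneg _) h1 2).trans h3

theorem energy_le_succ (hf : IsGlobalLengthPreservingFlow f)
    (hrot : HasRotationNumber (curveAt f 0) 1) (n : ℕ) (ht : 0 ≤ t) :
    energy f (length (curveAt f 0)) n t
      ≤ length (curveAt f 0) ^ 2 * energy f (length (curveAt f 0)) (n + 1) t := by
  set L := length (curveAt f 0) with hL
  have h := (hf.loop ht).arcIntegral_mono ((hf.continuous_devDeriv L n ht).pow 2)
    (continuous_const (y := L * energy f L (n + 1) t)) fun u hu => hf.sq_devDeriv_le hrot n ht hu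
  rw [arcIntegral_const, hf.length_eq hrot ht] at h
  refine h.trans_eq ?_
  rw [← hL]; ring

/-- Iterated Poincaré and Sobolev inequalities: orders strictly below `n` are controlled pointwise
by `E_n`, order `n` itself only in mean square. This is the reason for the strict inequalities in
`IsLower`. -/
theorem exists_bound_energy (hf : IsGlobalLengthPreservingFlow f)
    (hrot : HasRotationNumber (curveAt f 0) 1) (n : ℕ) : ∃ B, 0 ≤ B ∧ ∀ t, 0 ≤ t →
      (∀ i, i ≤ n → energy f (length (curveAt f 0)) i t
        ≤ B * energy f (length (curveAt f 0)) n t) ∧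
      ∀ j, j < n → ∀ u ∈ Set.Icc (0 : ℝ) 1, devDeriv f (length (curveAt f 0)) j u t ^ 2
        ≤ B * energy f (length (curveAt f 0)) n t := by
  set L := length (curveAt f 0)
  have hL : 0 < L := (hf.loop le_rfl).length_pos
  induction n with
  | zero =>
    refine ⟨1, zero_le_one, fun t ht => ⟨fun i hi => ?_, fun j hj => absurd hj (Nat.not_lt_zero j)⟩⟩
    rw [Nat.le_zero.1 hi, one_mul]
  | succ n ih =>
    obtain ⟨B, hB, h⟩ := ih
    refine ⟨B * L ^ 2 + 1 + L, by positivity, fun t ht => ?_⟩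
    have hE := energy_nonneg f L (n + 1) t
    have h1 : B * energy f L n t ≤ B * (L ^ 2 * energy f L (n + 1) t) :=
      mul_le_mul_of_nonneg_left (hf.energy_le_succ hrot n ht) hB
    have h2 : 0 ≤ L * energy f L (n + 1) t := by positivity
    have h3 : 0 ≤ B * (L ^ 2 * energy f L (n + 1) t) := by positivity
    refine ⟨fun i hi => ?_, fun j hj u hu => ?_⟩
    · rcases Nat.le_succ_iff.1 hi with hi | rfl
      · have := (h t ht).1 i hi; linarith
      · linarith
    · rcases Nat.lt_succ_iff_lt_or_eq.1 hj with hj | rfl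
      · have := (h t ht).2 j hj u hu; linarith
      · have := hf.sq_devDeriv_le hrot j ht hu; linarith

/-- A lower order term is controlled by the energy of the same order. -/
theorem exists_bound_of_isLower (hf : IsGlobalLengthPreservingFlow f)
    (hrot : HasRotationNumber (curveAt f 0) 1) {n : ℕ} {G : ℝ → ℝ → ℝ}
    (hG : IsLower f (length (curveAt f 0)) n G) : ∃ C, 0 ≤ C ∧ ∀ t, 0 < t →
      |arcInt f (fun u t => devDeriv f (length (curveAt f 0)) n u t * G u t) t|
        ≤ C * (energy f (length (curveAt f 0)) n t
          + energy f (length (curveAt f 0)) n t ^ 2) := by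
  set L := length (curveAt f 0)
  obtain ⟨B, hB, hBt⟩ := hf.exists_bound_energy hrot n
  -- Here `b` gathers the coefficient and the at most two factors of order below `n`; these cost at
  -- most one power of `E_n` pointwise, and the remaining two factors give another in mean square.
  have key : ∀ {b : ℝ → ℝ → ℝ} {A : ℝ} {i : ℕ}, 0 ≤ A → i ≤ n →
      (∀ t, 0 < t → Continuous fun u => b u t) →
      (∀ t, 0 < t → ∀ u ∈ Set.Icc (0 : ℝ) 1, |b u t| ≤ A * (1 + B * energy f L n t)) →
      ∃ C, 0 ≤ C ∧ ∀ t, 0 < t →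
      |arcInt f (fun u t => devDeriv f L n u t * (b u t * devDeriv f L i u t)) t|
        ≤ C * (energy f L n t + energy f L n t ^ 2) := by
    intro b A i hA hi hbc hb
    refine ⟨A * (1 + B) * (1 + B), by positivity, fun t ht => ?_⟩
    have hE := energy_nonneg f L n t
    set M := A * (1 + B * energy f L n t) with hM
    have hM0 : 0 ≤ M := by positivity
    have hn := hf.continuous_devDeriv L n ht.le
    have hic := hf.continuous_devDeriv L i ht.le
    have hbt := hbc t ht
    have h1 := (hf.loop ht.le).abs_arcIntegral_le
      (g := fun u => devDeriv f L n u t * (b u t * devDeriv f L i u t))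
      (h := fun u => M * (devDeriv f L n u t ^ 2 + devDeriv f L i u t ^ 2))
      (by fun_prop) (by fun_prop) fun u hu => by
        have h2 : |devDeriv f L n u t| * |devDeriv f L i u t|
            ≤ devDeriv f L n u t ^ 2 + devDeriv f L i u t ^ 2 := by
          rw [← sq_abs (devDeriv f L n u t), ← sq_abs (devDeriv f L i u t)]
          nlinarith [sq_nonneg (|devDeriv f L n u t| - |devDeriv f L i u t|),
            sq_nonneg (|devDeriv f L n u t|), sq_nonneg (|devDeriv f L i u t|)]
        calc |devDeriv f L n u t * (b u t * devDeriv f L i u t)|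
            = |b u t| * (|devDeriv f L n u t| * |devDeriv f L i u t|) := by
              rw [abs_mul, abs_mul]; ring
          _ ≤ M * (devDeriv f L n u t ^ 2 + devDeriv f L i u t ^ 2) :=
              mul_le_mul (hb t ht u hu) h2 (by positivity) hM0
    rw [arcIntegral_const_mul, (hf.loop ht.le).arcIntegral_add (by fun_prop) (by fun_prop)] at h1
    have h3 := (hBt t ht.le).1 i hi
    have h4 : energy f L n t + energy f L i t ≤ (1 + B) * energy f L n t := by linarith
    calc _ ≤ M * (energy f L n t + energy f L i t) := h1
      _ ≤ M * ((1 + B) * energy f L n t) := by gcongr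
      _ = A * (1 + B) * (energy f L n t + B * energy f L n t ^ 2) := by rw [hM]; ring
      _ ≤ A * (1 + B) * ((1 + B) * (energy f L n t + energy f L n t ^ 2)) := by
          gcongr
          nlinarith [sq_nonneg (energy f L n t), mul_nonneg hB hE]
      _ = _ := by ring
  have hnn : ∀ {a : ℝ → ℝ} {A : ℝ}, (∀ t, 0 < t → |a t| ≤ A) → 0 ≤ A := fun ha =>
    (abs_nonneg _).trans (ha 1 one_pos)
  induction hG with
  | @linear a A ha i hi =>
    refine key (hnn ha) hi (fun _ _ => continuous_const) fun t ht u hu => ?_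
    have hE := energy_nonneg f L n t
    have := ha t ht
    have h1 := mul_nonneg (hnn ha) (mul_nonneg hB hE)
    linarith
  | @quadratic a A ha i j hi hj =>
    refine key (hnn ha) hi
      (fun t ht => continuous_const.mul (hf.continuous_devDeriv L j ht.le)) fun t ht u hu => ?_
    have hE := energy_nonneg f L n t
    have h1 := (hBt t ht.le).2 j hj u hu
    rw [abs_mul]
    refine mul_le_mul (ha t ht) ?_ (abs_nonneg _) (hnn ha)
    rw [← sq_abs] at h1
    nlinarith [sq_nonneg (|devDeriv f L j u t| - 1), sq_nonneg (|devDeriv f L j u t|)]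
  | @cubic a A ha i j k hi hj hk =>
    refine key (hnn ha) hi
      (fun t ht => continuous_const.mul ((hf.continuous_devDeriv L j ht.le).mul
        (hf.continuous_devDeriv L k ht.le))) fun t ht u hu => ?_
    have hE := energy_nonneg f L n t
    have h1 := (hBt t ht.le).2 j hj u hu
    have h2 := (hBt t ht.le).2 k hk u hu
    rw [abs_mul]
    refine mul_le_mul (ha t ht) ?_ (abs_nonneg _) (hnn ha)
    rw [abs_le]
    constructor <;> nlinarith [sq_nonneg (devDeriv f L j u t - devDeriv f L k u t),
      sq_nonneg (devDeriv f L j u t + devDeriv f L k u t)]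
  | @add G H hG hH ihG ihH =>
    obtain ⟨C, hC, hCt⟩ := ihG
    obtain ⟨D, hD, hDt⟩ := ihH
    refine ⟨C + D, add_nonneg hC hD, fun t ht => ?_⟩
    have hn := hf.continuous_devDeriv L n ht.le
    have hGc := (hf.contDiff_of_isLower hG ht.le).continuous
    have hHc := (hf.contDiff_of_isLower hH ht.le).continuous
    have h1 : arcInt f (fun u t => devDeriv f L n u t * (G u t + H u t)) t
        = arcInt f (fun u t => devDeriv f L n u t * G u t) t
          + arcInt f (fun u t => devDeriv f L n u t * H u t) t := by
      simp only [arcInt, mul_add]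
      exact (hf.loop ht.le).arcIntegral_add (by fun_prop) (by fun_prop)
    rw [h1, add_mul]
    exact (abs_add_le _ _).trans (add_le_add (hCt t ht) (hDt t ht))

/-! ### Evolution of the energies -/

theorem timeDeriv_devDeriv_zero (hf : IsGlobalLengthPreservingFlow f) (L : ℝ) (ht : 0 < t)
    (u : ℝ) : timeDeriv (devDeriv f L 0) u t = devDeriv f L 2 u t
      + curv f u t ^ 2 * normalSpeed f u t := by
  have h1 : timeDeriv (devDeriv f L 0) u t = timeDeriv (curv f) u t := by
    simp only [timeDeriv, devDeriv, deriv_sub_const_fun]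
  have h2 : devDeriv f L 1 = arcD f (curv f) := by
    funext u t
    simp only [arcD, arcDeriv, devDeriv, deriv_sub_const_fun]
  rw [h1, hf.timeDeriv_curv ht, show devDeriv f L 2 = arcD f (devDeriv f L 1) from rfl, h2]

/-- One more arc length derivative differentiates the remainder and adds the commutator term `κF
∂ₛⁿ⁺¹w`. -/
theorem timeDeriv_devDeriv_succ (hf : IsGlobalLengthPreservingFlow f) (L : ℝ) (ht : 0 < t)
    {n : ℕ} {R : ℝ → ℝ → ℝ} {R' : ℝ → ℝ}
    (h : ∀ u, timeDeriv (devDeriv f L n) u t = devDeriv f L (n + 2) u t + R u t)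
    (hR : ∀ u, HasDerivAt (fun v => R v t) (speed f u t * R' u) u) (u : ℝ) :
    timeDeriv (devDeriv f L (n + 1)) u t = devDeriv f L (n + 3) u t
      + (R' u + curv f u t * normalSpeed f u t * devDeriv f L (n + 1) u t) := by
  have h1 := hf.timeDeriv_arcD ht (hf.family_devDeriv L n) u
  have h2 : arcD f (timeDeriv (devDeriv f L n)) u t = devDeriv f L (n + 3) u t + R' u := by
    refine hf.arcD_eq_of_hasDerivAt ht.le ?_
    simp only [h]
    refine ((hf.hasDerivAt_devDeriv L (n + 2) ht.le u).add (hR u)).congr_deriv ?_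
    ring
  refine h1.trans ?_
  rw [h2, smul_eq_mul, add_assoc]
  rfl

/-- `κF = (w + k)(w - m)` with `k = 2π/L` and `m = E_0/2π`. The bound on `E_0` makes the
coefficients bounded, and `0 < n` makes `w` of strictly lower order. -/
theorem isLower_curv_mul (hf : IsGlobalLengthPreservingFlow f)
    (hrot : HasRotationNumber (curveAt f 0) 1) {B : ℝ}
    (hB : ∀ t, 0 < t → energy f (length (curveAt f 0)) 0 t ≤ B) {n : ℕ} (hn : 0 < n) :
    ∃ G, IsLower f (length (curveAt f 0)) n G ∧ ∀ t, 0 < t → ∀ u,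
      curv f u t * normalSpeed f u t * devDeriv f (length (curveAt f 0)) n u t = G u t := by
  set L := length (curveAt f 0) with hL
  set k := 2 * Real.pi / L with hk
  set m : ℝ → ℝ := fun t => energy f L 0 t / (2 * Real.pi) with hm
  have hpi := Real.pi_pos
  have hmB : ∀ t, 0 < t → |m t| ≤ B / (2 * Real.pi) := fun t ht => by
    have := energy_nonneg f L 0 t
    have := hB t ht
    rw [abs_of_nonneg (by positivity)]
    simp only [hm]; gcongr
  refine ⟨_, .add (.cubic (a := fun _ => 1) (A := 1) (fun _ _ => by simp) le_rfl hn hn)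
    (.add (.quadratic (a := fun t => k - m t) (A := |k| + B / (2 * Real.pi))
      (fun t ht => (abs_sub _ _).trans (by have := hmB t ht; linarith)) le_rfl hn)
    (.linear (a := fun t => -(k * m t)) (A := |k| * (B / (2 * Real.pi)))
      (fun t ht => by rw [abs_neg, abs_mul]; gcongr; exact hmB t ht) le_rfl)), fun t ht u => ?_⟩
  have h1 : curv f u t = devDeriv f L 0 u t + k := by simp only [devDeriv, hk]; ring
  rw [hf.normalSpeed_eq hrot ht.le, h1, ← hL]
  simp only [hm]; ring

/-- Up to lower order terms, the derivatives of the curvature deviation solve the heat equation. -/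
theorem exists_isLower_timeDeriv (hf : IsGlobalLengthPreservingFlow f)
    (hrot : HasRotationNumber (curveAt f 0) 1) {B : ℝ}
    (hB : ∀ t, 0 < t → energy f (length (curveAt f 0)) 0 t ≤ B) (n : ℕ) :
    ∃ R, IsLower f (length (curveAt f 0)) (n + 1) R ∧ ∀ t, 0 < t → ∀ u,
      timeDeriv (devDeriv f (length (curveAt f 0)) (n + 1)) u t
        = devDeriv f (length (curveAt f 0)) (n + 3) u t + R u t := by
  set L := length (curveAt f 0) with hL
  induction n with
  | zero =>
    set k := 2 * Real.pi / L with hk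
    obtain ⟨G, hG, hGe⟩ := hf.isLower_curv_mul hrot hB one_pos
    -- Two copies of `κF ∂ₛw` come from `∂ₛ(κ²F) = 2κF κₛ + κ² κₛ`, the third from the commutator;
    -- the last three terms expand `κ² κₛ` with `κ = w + k`.
    refine ⟨_, .add hG (.add hG (.add hG (.add
      (.cubic (a := fun _ => 1) (A := 1) (fun _ _ => by simp) le_rfl one_pos one_pos) (.add
      (.quadratic (a := fun _ => 2 * k) (A := |2 * k|) (fun _ _ => le_rfl) le_rfl one_pos)
      (.linear (a := fun _ => k ^ 2) (A := |k ^ 2|) (fun _ _ => le_rfl) le_rfl))))),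
      fun t ht u => ?_⟩
    have h1 : ∀ u, curv f u t = devDeriv f L 0 u t + k := fun u => by
      simp only [devDeriv, hk]; ring
    have h2 : ∀ u, HasDerivAt (fun v => curv f v t ^ 2 * normalSpeed f v t)
        (speed f u t * ((2 * (curv f u t * normalSpeed f u t) + curv f u t ^ 2)
          * devDeriv f L 1 u t)) u := by
      intro u
      have hκ : HasDerivAt (fun v => curv f v t) (speed f u t * devDeriv f L 1 u t) u := by
        simp only [h1]
        exact (hf.hasDerivAt_devDeriv L 0 ht.le u).add_const _
      refine ((hκ.pow 2).mul (hκ.sub_const _)).congr_deriv ?_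
      simp only [normalSpeed, Pi.pow_apply]; push_cast; ring
    have h3 := hf.timeDeriv_devDeriv_succ L ht (R := fun u t => curv f u t ^ 2 * normalSpeed f u t)
      (hf.timeDeriv_devDeriv_zero L ht) h2 u
    refine h3.trans ?_
    rw [← hGe t ht u, ← hL]
    have h4 : curv f u t ^ 2 = devDeriv f L 0 u t * devDeriv f L 0 u t
      + 2 * k * devDeriv f L 0 u t + k ^ 2 := by rw [h1]; ring
    simp only [zero_add]
    linear_combination devDeriv f L 1 u t * h4
  | succ n ih =>
    obtain ⟨R, hR, hRe⟩ := ih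
    obtain ⟨R', hR', hRd⟩ := hf.hasDerivAt_of_isLower hR
    obtain ⟨G, hG, hGe⟩ := hf.isLower_curv_mul hrot hB (n + 1).succ_pos
    refine ⟨_, .add hR' hG, fun t ht u => ?_⟩
    rw [← hGe t ht u]
    exact hf.timeDeriv_devDeriv_succ L ht (hRe t ht) (hRd t ht.le) u

/-- Integration by parts turns the diffusion term into `-2E_{n+1}`; the last term of the integrand
is the variation of `ds`. -/
theorem hasDerivAt_energy (hf : IsGlobalLengthPreservingFlow f) (L : ℝ) (ht : 0 < t) {n : ℕ}
    {R : ℝ → ℝ → ℝ} (hRc : Continuous fun u => R u t)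
    (h : ∀ u, timeDeriv (devDeriv f L n) u t = devDeriv f L (n + 2) u t + R u t) :
    HasDerivAt (energy f L n) (-2 * energy f L (n + 1) t
      + arcInt f (fun u t => 2 * (devDeriv f L n u t * R u t)
        - devDeriv f L n u t * (curv f u t * normalSpeed f u t * devDeriv f L n u t)) t) t := by
  refine (hf.hasDerivAt_arcInt ht (hf.family_sq_devDeriv L n)).congr_deriv ?_
  have hloop := hf.loop ht.le
  have h1 := hloop.arcIntegral_by_parts (hf.contDiff_devDeriv L n ht.le)
    (hf.contDiff_devDeriv L (n + 1) ht.le) ((hf.family_devDeriv L n).periodic t ht.le)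
    ((hf.family_devDeriv L (n + 1)).periodic t ht.le)
  have h2 : arcIntegral (curveAt f t) (fun u => devDeriv f L n u t * devDeriv f L (n + 2) u t)
      = - energy f L (n + 1) t := by
    refine h1.trans (congrArg Neg.neg (congrArg (arcIntegral (curveAt f t)) (funext fun u => ?_)))
    exact (sq _).symm
  have h3 : ∀ u, timeDeriv (fun u t => devDeriv f L n u t ^ 2) u t
      = 2 * (devDeriv f L n u t * devDeriv f L (n + 2) u t)
        + 2 * (devDeriv f L n u t * R u t) := by
    intro u
    refine (((hf.family_devDeriv L n).hasDerivAt_time ht u).pow 2).deriv.trans ?_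
    rw [h]; push_cast; ring
  have hn := hf.continuous_devDeriv L n ht.le
  have hn2 := hf.continuous_devDeriv L (n + 2) ht.le
  have hκ := hf.continuous_curv ht.le
  have hF : Continuous fun u => normalSpeed f u t := hκ.sub continuous_const
  have h4 : arcInt f (fun u t => timeDeriv (fun u t => devDeriv f L n u t ^ 2) u t
      - curv f u t * normalSpeed f u t * devDeriv f L n u t ^ 2) t
      = arcIntegral (curveAt f t) (fun u => 2 * (devDeriv f L n u t * devDeriv f L (n + 2) u t)
        + (2 * (devDeriv f L n u t * R u t)
          - devDeriv f L n u t * (curv f u t * normalSpeed f u t * devDeriv f L n u t))) := by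
    refine congrArg (arcIntegral (curveAt f t)) (funext fun u => ?_)
    simp only [h3]; ring
  rw [h4, hloop.arcIntegral_add (by fun_prop) (by fun_prop), arcIntegral_const_mul, h2]
  simp only [arcInt]; ring

theorem hasDerivAt_energy_succ_le (hf : IsGlobalLengthPreservingFlow f)
    (hrot : HasRotationNumber (curveAt f 0) 1) {B : ℝ}
    (hB : ∀ t, 0 < t → energy f (length (curveAt f 0)) 0 t ≤ B) (n : ℕ) :
    ∃ (E' : ℝ → ℝ) (C : ℝ), 0 ≤ C ∧ ∀ t, 0 < t →
      HasDerivAt (energy f (length (curveAt f 0)) (n + 1)) (E' t) t ∧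
      E' t ≤ -energy f (length (curveAt f 0)) (n + 2) t
        + C * (energy f (length (curveAt f 0)) (n + 1) t
          + energy f (length (curveAt f 0)) (n + 1) t ^ 3) := by
  set L := length (curveAt f 0) with hL
  obtain ⟨R, hR, hRe⟩ := hf.exists_isLower_timeDeriv hrot hB n
  obtain ⟨G, hG, hGe⟩ := hf.isLower_curv_mul hrot hB n.succ_pos
  obtain ⟨C, hC, hCt⟩ := hf.exists_bound_of_isLower hrot hR
  obtain ⟨D, hD, hDt⟩ := hf.exists_bound_of_isLower hrot hG
  refine ⟨_, 2 * (2 * C + D), by positivity, fun t ht =>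
    ⟨hf.hasDerivAt_energy L ht (hf.contDiff_of_isLower hR ht.le).continuous (hRe t ht), ?_⟩⟩
  have hn := hf.continuous_devDeriv L (n + 1) ht.le
  have hRc := (hf.contDiff_of_isLower hR ht.le).continuous
  have hGc := (hf.contDiff_of_isLower hG ht.le).continuous
  have h1 : arcInt f (fun u t => 2 * (devDeriv f L (n + 1) u t * R u t)
        - devDeriv f L (n + 1) u t * (curv f u t * normalSpeed f u t * devDeriv f L (n + 1) u t)) t
      = 2 * arcInt f (fun u t => devDeriv f L (n + 1) u t * R u t) t
        - arcInt f (fun u t => devDeriv f L (n + 1) u t * G u t) t := by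
    simp only [arcInt]
    rw [← arcIntegral_const_mul, ← (hf.loop ht.le).arcIntegral_sub (by fun_prop) (by fun_prop)]
    refine congrArg (arcIntegral (curveAt f t)) (funext fun u => ?_)
    simp only [← hGe t ht u, Nat.succ_eq_add_one, ← hL]
  rw [h1]
  have h2 := (abs_le.1 (hCt t ht)).2
  have h3 := (abs_le.1 (hDt t ht)).1
  have hE := energy_nonneg f L (n + 1) t
  have hE2 := energy_nonneg f L (n + 2) t
  set x := energy f L (n + 1) t
  have h4 : x + x ^ 2 ≤ 2 * (x + x ^ 3) := by
    nlinarith [mul_nonneg hE (sq_nonneg (x - 1)), pow_nonneg hE 3]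
  have h5 : (2 * C + D) * (x + x ^ 2) ≤ (2 * C + D) * (2 * (x + x ^ 3)) := by gcongr
  simp only [Nat.succ_eq_add_one] at h3
  rw [show n + 1 + 1 = n + 2 from rfl]
  linarith

/-- At order zero no factor has lower order, so `∫ w⁴ ds` is estimated through the supremum of `w²`,
at the expense of one of the two copies of `E_1` from diffusion. -/
theorem hasDerivAt_energy_zero_le (hf : IsGlobalLengthPreservingFlow f)
    (hrot : HasRotationNumber (curveAt f 0) 1) :
    ∃ (E' : ℝ → ℝ) (C : ℝ), 0 ≤ C ∧ ∀ t, 0 < t →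
      HasDerivAt (energy f (length (curveAt f 0)) 0) (E' t) t ∧
      E' t ≤ -energy f (length (curveAt f 0)) 1 t
        + C * (energy f (length (curveAt f 0)) 0 t
          + energy f (length (curveAt f 0)) 0 t ^ 3) := by
  have hL0 : 0 < length (curveAt f 0) := (hf.loop le_rfl).length_pos
  have hmean := fun {t : ℝ} (ht : 0 < t) => hf.arcInt_devDeriv_zero hrot ht.le
  have hlen := fun {t : ℝ} (ht : 0 < t) => hf.length_eq hrot ht.le
  have hNS := fun {t : ℝ} (ht : 0 < t) => hf.normalSpeed_eq hrot ht.le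
  set L := length (curveAt f 0) with hL
  set k := 2 * Real.pi / L with hk
  have hpi := Real.pi_pos
  have hk0 : 0 < k := by positivity
  -- The bound obtained is `-E_1 + (2/L) E² + 5E³ + 7k²E`, where `5E³` is `4E³` from Young's
  -- inequality plus `m²E ≤ E³`; then `E² ≤ E + E³`.
  refine ⟨_, 2 / L + 5 + 7 * k ^ 2, by positivity, fun t ht => ⟨hf.hasDerivAt_energy L ht
    (R := fun u t => curv f u t ^ 2 * normalSpeed f u t)
    (((hf.continuous_curv ht.le).pow 2).mul ((hf.continuous_curv ht.le).sub continuous_const))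
    (hf.timeDeriv_devDeriv_zero L ht), ?_⟩⟩
  have hloop := hf.loop ht.le
  have hc0 := hf.continuous_devDeriv L 0 ht.le
  have hc1 := hf.continuous_devDeriv L 1 ht.le
  set E := energy f L 0 t with hE
  have hE0 : 0 ≤ E := energy_nonneg f L 0 t
  set m := E / (2 * Real.pi) with hm
  have hm0 : 0 ≤ m := by positivity
  have hmE : m ≤ E := div_le_self hE0 (by have := Real.two_le_pi; linarith)
  set w : ℝ → ℝ := fun u => devDeriv f L 0 u t with hw
  have hcurv : ∀ u, curv f u t = w u + k := fun u => by simp only [hw, devDeriv, hk]; ring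
  have hIE : arcIntegral (curveAt f t) (fun u => w u ^ 2) = E := rfl
  have hIE1 : arcIntegral (curveAt f t) (fun u => devDeriv f L 1 u t ^ 2) = energy f L 1 t := rfl
  have hIw : arcIntegral (curveAt f t) w = 0 := hmean ht
  -- pointwise bound of the square of the curvature deviation
  have hsup : ∀ u ∈ Set.Icc (0 : ℝ) 1, w u ^ 2 ≤ E / L
      + arcIntegral (curveAt f t) (fun u => |2 * (w u * devDeriv f L 1 u t)|) := by
    intro u hu
    have h1 := hloop.abs_le_of_arcDeriv ((hf.contDiff_devDeriv L 0 ht.le).pow 2) hu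
    have h2 : arcDeriv (curveAt f t) (fun u => devDeriv f L 0 u t ^ 2)
        = fun u => 2 * (w u * devDeriv f L 1 u t) := by
      funext u
      refine hf.arcD_eq_of_hasDerivAt (G := fun u t => devDeriv f L 0 u t ^ 2) ht.le ?_
      refine ((hf.hasDerivAt_devDeriv L 0 ht.le u).pow 2).congr_deriv ?_
      simp only [hw]; push_cast; ring
    rw [h2, hlen ht, abs_of_nonneg (sq_nonneg _)] at h1
    refine h1.trans_eq ?_
    rw [show arcIntegral (curveAt f t) (fun u => devDeriv f L 0 u t ^ 2) = E from rfl,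
      abs_of_nonneg hE0]
  set X := arcIntegral (curveAt f t) (fun u => |2 * (w u * devDeriv f L 1 u t)|) with hX
  -- Young's inequality, weighted so that exactly one `E_1` is spent.
  have hEX : 2 * E * X ≤ energy f L 1 t + 4 * E ^ 2 * E := by
    have h1 := hloop.arcIntegral_mono (g := fun u => (2 * E) * |2 * (w u * devDeriv f L 1 u t)|)
      (h := fun u => devDeriv f L 1 u t ^ 2 + (4 * E ^ 2) * w u ^ 2) (by fun_prop) (by fun_prop)
      fun u _ => by
        rw [abs_mul, abs_mul, abs_of_pos (two_pos : (0 : ℝ) < 2), ← sq_abs (w u),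
          ← sq_abs (devDeriv f L 1 u t)]
        nlinarith [sq_nonneg (|devDeriv f L 1 u t| - 2 * E * |w u|)]
    rw [arcIntegral_const_mul, hloop.arcIntegral_add (by fun_prop) (by fun_prop),
      arcIntegral_const_mul, hIE, hIE1] at h1
    exact h1
  have hI4 : arcIntegral (curveAt f t) (fun u => w u ^ 4) ≤ (E / L + X) * E := by
    have h1 := hloop.arcIntegral_mono (g := fun u => w u ^ 4)
      (h := fun u => (E / L + X) * w u ^ 2) (by fun_prop) (by fun_prop) fun u hu => by
        rw [show w u ^ 4 = w u ^ 2 * w u ^ 2 by ring]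
        exact mul_le_mul_of_nonneg_right (hsup u hu) (sq_nonneg _)
    rwa [arcIntegral_const_mul, hIE] at h1
  -- The cubic term `(3k - m) w³` is split by completing a square into `w⁴` and a multiple of `w²`;
  -- the term linear in `w` integrates to zero.
  have hmain : arcInt f (fun u t => 2 * (devDeriv f L 0 u t
        * (curv f u t ^ 2 * normalSpeed f u t))
      - devDeriv f L 0 u t * (curv f u t * normalSpeed f u t * devDeriv f L 0 u t)) t
      ≤ 2 * arcIntegral (curveAt f t) (fun u => w u ^ 4) + (7 * k ^ 2 + m ^ 2) * E := by
    have h1 := hloop.arcIntegral_mono (g := fun u => 2 * (w u * ((w u + k) ^ 2 * (w u - m)))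
        - w u * ((w u + k) * (w u - m) * w u))
      (h := fun u => 2 * w u ^ 4 + (7 * k ^ 2 + m ^ 2) * w u ^ 2 + (-2 * k ^ 2 * m) * w u)
      (by fun_prop) (by fun_prop) fun u _ => by
        have e : 2 * (w u * ((w u + k) ^ 2 * (w u - m))) - w u * ((w u + k) * (w u - m) * w u)
          = w u ^ 4 + (3 * k - m) * w u * w u ^ 2 + (2 * k ^ 2 - 3 * k * m) * w u ^ 2
            + (-2 * k ^ 2 * m) * w u := by ring
        rw [e]
        nlinarith [mul_nonneg (sq_nonneg (w u)) (sq_nonneg (w u - (3 * k - m) / 2)),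
          mul_nonneg (sq_nonneg (w u)) (mul_nonneg hk0.le hm0),
          mul_nonneg (sq_nonneg (w u)) (sq_nonneg m), mul_nonneg (sq_nonneg (w u)) (sq_nonneg k)]
    rw [hloop.arcIntegral_add (by fun_prop) (by fun_prop),
      hloop.arcIntegral_add (by fun_prop) (by fun_prop), arcIntegral_const_mul,
      arcIntegral_const_mul, arcIntegral_const_mul, hIE, hIw, mul_zero, add_zero] at h1
    refine le_trans (le_of_eq ?_) h1
    refine congrArg (arcIntegral (curveAt f t)) (funext fun u => ?_)
    simp only [hcurv, hNS ht, ← hE, ← hm]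
    rfl
  have h4 : E ^ 2 ≤ E + E ^ 3 := by nlinarith [mul_nonneg hE0 (sq_nonneg (E - 1)), pow_nonneg hE0 2]
  have h5 : 2 / L * E ^ 2 ≤ 2 / L * (E + E ^ 3) := by gcongr
  have h6 : m ^ 2 * E ≤ E ^ 2 * E := by gcongr
  have h7 : 0 ≤ k ^ 2 * E ^ 3 := by positivity
  have h8 : E / L * E = 1 / L * E ^ 2 := by ring
  have h9 : 2 / L * E ^ 2 = 2 * (1 / L * E ^ 2) := by ring
  refine (add_le_add_right hmain _).trans ?_
  rw [zero_add]
  nlinarith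

end IsGlobalLengthPreservingFlow

end Flow

end PlaneCurve

/-! ### Exponential decay of all energies -/

namespace PlaneCurve

section Flow

variable {f : ℝ → ℝ → ℂ} {t : ℝ}

namespace IsGlobalLengthPreservingFlow

/-- The deficit `D` satisfies `D' = -2L E_0` and `|D| ≤ L³ E_0`, whence the rate `2L / L³`. -/
theorem exists_integral_energy_zero_le (hf : IsGlobalLengthPreservingFlow f)
    (hrot : HasRotationNumber (curveAt f 0) 1) :
    ∃ lam : ℝ, 0 < lam ∧ ∃ K : ℝ, ∀ t, 0 ≤ t →
      ∫ s in t..t + 1, energy f (length (curveAt f 0)) 0 s ≤ K * Real.exp (-lam * t) := by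
  have hL : 0 < length (curveAt f 0) := (hf.loop le_rfl).length_pos
  have hlen := fun {t : ℝ} (ht : 0 ≤ t) => hf.length_eq hrot ht
  have harea := fun {t : ℝ} (ht : 0 < t) => hf.hasDerivAt_signedArea hrot ht
  set L := length (curveAt f 0)
  have hpi := Real.pi_pos
  refine ⟨2 * L / L ^ 3, by positivity, integral_le_exp_of_deficit
    (D := fun t => L ^ 2 - 4 * Real.pi * signedArea (curveAt f t)) (a := 2 * L) (b := L ^ 3)
    (B := 4 * Real.pi * (L ^ 2 / 2)) (by positivity) (by positivity)
    (continuousOn_const.sub (hf.continuousOn_signedArea.const_mul _))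
    (hf.continuousOn_energy L 0) (fun t ht => ?_) (energy_nonneg f L 0) (fun t ht => ?_)
    fun t ht => ?_⟩
  · refine (((harea ht).const_mul (4 * Real.pi)).const_sub (L ^ 2)).congr_deriv ?_
    field_simp
    ring
  · have := (hf.loop ht).abs_deficit_le
    rw [hlen ht] at this
    exact this
  · have := (abs_le.1 (hf.loop ht).abs_signedArea_le).2
    rw [hlen ht] at this
    have h1 : 4 * Real.pi * signedArea (curveAt f t) ≤ 4 * Real.pi * (L ^ 2 / 2) := by gcongr
    have h2 := sq_nonneg L
    linarith

/-- All energies decay exponentially, at the same rate. -/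
theorem exists_energy_le (hf : IsGlobalLengthPreservingFlow f)
    (hrot : HasRotationNumber (curveAt f 0) 1) :
    ∃ lam : ℝ, 0 < lam ∧ ∀ n, ∃ K : ℝ, ∀ t, 0 ≤ t →
      energy f (length (curveAt f 0)) n t ≤ K * Real.exp (-lam * t) := by
  obtain ⟨lam, hlam, hint⟩ := hf.exists_integral_energy_zero_le hrot
  set L := length (curveAt f 0) with hL
  have hdecay : ∀ n, (∃ K : ℝ, ∀ t, 0 ≤ t →
        ∫ s in t..t + 1, energy f L n s ≤ K * Real.exp (-lam * t)) →
      (∃ (E' : ℝ → ℝ) (C : ℝ), 0 ≤ C ∧ ∀ t, 0 < t → HasDerivAt (energy f L n) (E' t) t ∧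
        E' t ≤ -energy f L (n + 1) t + C * (energy f L n t + energy f L n t ^ 3)) →
      (∃ K : ℝ, ∀ t, 0 ≤ t → energy f L n t ≤ K * Real.exp (-lam * t)) ∧
        ∃ K : ℝ, ∀ t, 0 ≤ t →
          ∫ s in t..t + 1, energy f L (n + 1) s ≤ K * Real.exp (-lam * t) := by
    rintro n ⟨K, hK⟩ ⟨E', C, hC, h⟩
    exact exp_decay_of_integral hC hlam (hf.continuousOn_energy L n)
      (hf.continuousOn_energy L (n + 1)) (energy_nonneg f L n) (energy_nonneg f L (n + 1))
      (fun t ht => (h t ht).1) (fun t ht => (h t ht).2) hK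
  have h0 := hdecay 0 hint (hf.hasDerivAt_energy_zero_le hrot)
  obtain ⟨B, hB⟩ := h0.1
  have hB0 : 0 ≤ B := by
    have := (energy_nonneg f L 0 0).trans (hB 0 le_rfl)
    simpa using this
  -- The higher-order inequalities need a uniform bound on `E_0`, so order zero has to be settled
  -- before the induction.
  have hbd : ∀ t, 0 < t → energy f L 0 t ≤ B := fun t ht =>
    (hB t ht.le).trans (mul_le_of_le_one_right hB0 (Real.exp_le_one_iff.2 (by nlinarith)))
  have hall : ∀ n, (∃ K : ℝ, ∀ t, 0 ≤ t → energy f L n t ≤ K * Real.exp (-lam * t)) ∧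
      ∃ K : ℝ, ∀ t, 0 ≤ t →
        ∫ s in t..t + 1, energy f L (n + 1) s ≤ K * Real.exp (-lam * t) := by
    intro n
    induction n with
    | zero => exact h0
    | succ n ih => exact hdecay (n + 1) ih.2 (hf.hasDerivAt_energy_succ_le hrot hbd n)
  exact ⟨lam, hlam, fun n => (hall n).1⟩

/-- By the two conservation laws the mean curvature over the curve at time `t` is the constant
`2π/L` of the initial curve. -/
theorem iterate_arcDeriv_curvatureDeviation (hf : IsGlobalLengthPreservingFlow f)
    (hrot : HasRotationNumber (curveAt f 0) 1) (ht : 0 ≤ t) (n : ℕ) :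
    (arcDeriv (curveAt f t))^[n] (curvatureDeviation (curveAt f t))
      = fun u => devDeriv f (length (curveAt f 0)) n u t := by
  induction n with
  | zero =>
    funext u
    have h : arcIntegral (curveAt f t) (curvature (curveAt f t)) = 2 * Real.pi :=
      hf.arcInt_curv hrot ht
    simp only [Function.iterate_zero, id, curvatureDeviation, h, hf.length_eq hrot ht, devDeriv,
      curv]
    ring
  | succ n ih => rw [Function.iterate_succ_apply', ih]; rfl

theorem devEnergy_eq (hf : IsGlobalLengthPreservingFlow f)
    (hrot : HasRotationNumber (curveAt f 0) 1) (ht : 0 ≤ t) (n : ℕ) :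
    devEnergy n (curveAt f t)
      = length (curveAt f 0) ^ (2 * n + 1) * energy f (length (curveAt f 0)) n t := by
  simp only [devEnergy, hf.length_eq hrot ht, hf.iterate_arcDeriv_curvatureDeviation hrot ht,
    sq_abs]
  rfl

end IsGlobalLengthPreservingFlow

end Flow

end PlaneCurve

theorem theorem11 (f : ℝ → ℝ → ℂ)
    (hf : PlaneCurve.IsGlobalLengthPreservingFlow f)
    (hrot : PlaneCurve.HasRotationNumber (fun u => f u 0) 1)
    (harea : 0 < PlaneCurve.signedArea (fun u => f u 0)) :
    ∀ l : ℕ, ∃ C : ℝ, 0 < C ∧ ∃ lam : ℝ, 0 < lam ∧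
      ∀ t : ℝ, 0 ≤ t →
        PlaneCurve.devEnergy l (fun u => f u t) ≤ C * Real.exp (-lam * t) := by
  intro l
  obtain ⟨lam, hlam, h⟩ := hf.exists_energy_le hrot
  obtain ⟨K, hK⟩ := h l
  set L := PlaneCurve.length (PlaneCurve.curveAt f 0) with hL
  have hL0 : 0 < L := (hf.loop le_rfl).length_pos
  -- The maximum with `1` makes the constant strictly positive.
  refine ⟨L ^ (2 * l + 1) * max K 1, by positivity, lam, hlam, fun t ht => ?_⟩
  refine (hf.devEnergy_eq hrot ht l).trans_le ?_
  rw [mul_assoc]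
  refine mul_le_mul_of_nonneg_left ((hK t ht).trans ?_) (by positivity)
  gcongr
  exact le_max_left _ _
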